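/- Let $G$ be the group of real matrices $$\begin{pmatrix}1&x&z&0&0\\0&1&y&0&0\\0&0&1&0&0\\0&0&0&1&t\\0&0&0&0&1\end{pmatrix},\qquad x,y,z,t\in\mathbb R,$$ let $\Gamma\subset G$ be the subgroup of matrices with integral entries, acting by left multiplication, and let $M=\Gamma\backslash G$ (the Kodaira--Thurston manifold, a compact Hausdorff smooth $4$-manifold). The vector fields $e_1=\partial_t$, $e_2=\partial_x$, $e_3=\partial_y+x\,\partial_z$, $e_4=\partial_z$ on $G$ descend to a global frame of $M$. Let $\Delta=\{t\in\mathbb C:|t|<\pi\}$ with its standard complex structure, let $e_5=\partial/\partial\operatorname{Re}t$, $e_6=\partial/\partial\operatorname{Im}t$, and let $J$ be the endomorphism of the tangent bundle of $M\times\Delta$ whose matrix in the frame $e_1,\dots,e_6$ is $$\begin{pmatrix}0&-1&0&0&0&0\\1&0&0&0&0&0\\0&0&-\frac{\operatorname{Im}t}{\operatorname{Re}t+\pi}&-\frac{|t+\pi|^2}{\operatorname{Re}t+\pi}&0&0\\0&0&\frac1{\operatorname{Re}t+\pi}&\frac{\operatorname{Im}t}{\operatorname{Re}t+\pi}&0&0\\0&0&0&0&0&-1\\0&0&0&0&1&0\end{pmatrix}.$$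 For an almost complex manifold $X$ of complex dimension $n$ with canonical bundle $\omega_X=\Lambda^{n,0}T^*X$, the operator $\bar\partial$ on $(n,0)$-forms is the $(n,1)$-part of $d$; it is extended to $\omega_X^{\otimes m}$ by the Leibniz rule. Put $P_m(X)=\dim_{\mathbb C}\{\varphi \text{ a smooth section of }\omega_X^{\otimes m}:\bar\partial\varphi=0\}$, and let $\operatorname{kod}(X)=-\infty$ if $P_m(X)=0$ for all $m\ge1$ and $\operatorname{kod}(X)=\limsup_{m\to\infty}\frac{\log P_m(X)}{\log m}$ otherwise (with $\log 0=-\infty$). Then: 1. $J$ is an almost complex structure on $M\times\Delta$ (it is smooth and $J^2=-\mathrm{id}$), and the projection $M\times\Delta\to\Delta$ is pseudoholomorphic (it is smooth and its differential commutes with the almost complex structures). 2. For every $t\in\Delta$, $J$ restricts to an almost complex structure $J_t$ on the fibre $M_t=M\times\{t\}$, so that the inclusion $M_t\to M\times\Delta$ is pseudoholomorphic. 3. For every real $t$ with $|t|<\pi$, $\operatorname{kod}(M_t,J_t)=-\infty$ if $t\notin\pi\mathbb Q$, and $\operatorname{kod}(M_t,J_t)=0$ if $t\in\pi\mathbb Q$.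 4. For every $m\ge1$, the plurigenus $P_m(M_t,J_t)$ is finite for all $t\in\Delta$ and is an upper semicontinuous function of $t\in\Delta$. 5. The function $t\mapsto\operatorname{kod}(M_t,J_t)$ on $\Delta$ is neither upper nor lower semicontinuous. More precisely, its restriction to the real interval $(-\pi,\pi)$ is not upper semicontinuous at any $t\notin\pi\mathbb Q$ and not lower semicontinuous at any $t\in\pi\mathbb Q$. -/

import Mathlib

open scoped Manifold ContDiff Topology
open Set

noncomputable section

/-! ## Almost complex manifolds -/

namespace AlmostComplex

section General

variable {E : Type*} [NormedAddCommGroup E] [NormedSpace ℝ E]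
  {H : Type*} [TopologicalSpace H] (I : ModelWithCorners ℝ E H)
  {M : Type*} [TopologicalSpace M] [ChartedSpace H M]
  {E' : Type*} [NormedAddCommGroup E'] [NormedSpace ℝ E']
  {H' : Type*} [TopologicalSpace H'] (I' : ModelWithCorners ℝ E' H')
  {M' : Type*} [TopologicalSpace M'] [ChartedSpace H' M']

/-- `J` is an almost complex structure on the smooth manifold `M`: a smooth bundle endomorphism
`J : TM → TM` with `J² = -id`. -/
structure IsAlmostComplexStructure [IsManifold I 1 M]
    (J : ∀ x : M, TangentSpace I x →L[ℝ] TangentSpace I x) : Prop where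
  sq_eq_neg : ∀ (x : M) (v : TangentSpace I x), J x (J x v) = -v
  smooth : ContMDiff I.tangent I.tangent ∞
    (fun v : TangentBundle I M => (⟨v.1, J v.1 v.2⟩ : TangentBundle I M))

/-- A map between almost complex manifolds is pseudoholomorphic if it is smooth and
its differential commutes with the almost complex structures. -/
structure IsPseudoholomorphic
    (J : ∀ x : M, TangentSpace I x →L[ℝ] TangentSpace I x)
    (J' : ∀ x : M', TangentSpace I' x →L[ℝ] TangentSpace I' x) (f : M → M') : Prop where
  smooth : ContMDiff I I' ∞ f
  comm : ∀ (x : M) (v : TangentSpace I x),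
    mfderiv I I' f x (J x v) = J' (f x) (mfderiv I I' f x v)

end General

/-! ## Pluricanonical sections and Kodaira dimension

The manifold `M` is modelled on the real normed space `E` (no boundary). Complex valued `k`-forms
are alternating real multilinear forms on the (real) tangent spaces with values in `ℂ`; they are
the same thing as complex alternating forms on the complexified tangent spaces. -/

section Forms

variable {E : Type*} [NormedAddCommGroup E] [NormedSpace ℝ E]
  {M : Type*} [TopologicalSpace M] [ChartedSpace E M]

/-- The fibre at `x` of the bundle of complex valued `k`-forms. -/
abbrev FormFibre (E : Type*) [NormedAddCommGroup E] [NormedSpace ℝ E]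
    {M : Type*} [TopologicalSpace M] [ChartedSpace E M] (k : ℕ) (x : M) : Type _ :=
  (TangentSpace 𝓘(ℝ, E) x) [⋀^Fin k]→L[ℝ] ℂ

/-- The coordinate expression of a form in the chart at `x₀`: its pull-back along the inverse
of the chart. -/
def formInChart {k : ℕ} (ψ : ∀ x : M, FormFibre E k x) (x₀ : M) (y : E) : E [⋀^Fin k]→L[ℝ] ℂ :=
  (ψ ((extChartAt 𝓘(ℝ, E) x₀).symm y)).compContinuousLinearMap
    (mfderiv 𝓘(ℝ, E) 𝓘(ℝ, E) (extChartAt 𝓘(ℝ, E) x₀).symm y)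

/-- Smoothness of a form on an open set `U`, i.e. smoothness of its coordinate expressions. -/
def IsSmoothFormOn {k : ℕ} (ψ : ∀ x : M, FormFibre E k x) (U : Set M) : Prop :=
  ∀ x₀ : M, ContDiffOn ℝ ∞ (formInChart ψ x₀)
    ((extChartAt 𝓘(ℝ, E) x₀).target ∩ (extChartAt 𝓘(ℝ, E) x₀).symm ⁻¹' U)

/-- The exterior differential of a form at the point `x`, computed in the chart at `x`. -/
def extDerivAt {k : ℕ} (ψ : ∀ x : M, FormFibre E k x) (x : M) : FormFibre E (k + 1) x :=
  (extDeriv (formInChart ψ x) (extChartAt 𝓘(ℝ, E) x x)).compContinuousLinearMap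
    (mfderiv 𝓘(ℝ, E) 𝓘(ℝ, E) (extChartAt 𝓘(ℝ, E) x) x)

variable (J : ∀ x : M, TangentSpace 𝓘(ℝ, E) x →L[ℝ] TangentSpace 𝓘(ℝ, E) x)

/-- A `k`-form at `x` is of type `(k, 0)` if it is `J`-complex linear in each variable. -/
def IsTypeZero {k : ℕ} (x : M) (A : FormFibre E k x) : Prop :=
  ∀ (w : Fin k → TangentSpace 𝓘(ℝ, E) x) (i : Fin k),
    A (Function.update w i (J x (w i))) = Complex.I * A w

/-- The underlying multilinear map of the component of type `(k, 0)`: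
`A ↦ A(w₁^{1,0}, …, w_k^{1,0})` where `w^{1,0} = (w - i J w) / 2` and `A` is extended complex
linearly to the complexified tangent space, expanded by multilinearity. -/
def projMultilinear {k : ℕ} (x : M) (A : FormFibre E k x) :
    ContinuousMultilinearMap ℝ (fun _ : Fin k => TangentSpace 𝓘(ℝ, E) x) ℂ :=
  ∑ S : Finset (Fin k), ((1 / 2 : ℂ) ^ k * (-Complex.I) ^ S.card) •
    A.toContinuousMultilinearMap.compContinuousLinearMap
      (fun i => if i ∈ S then J x else ContinuousLinearMap.id ℝ _)

theorem projMultilinear_apply {k : ℕ} (x : M) (A : FormFibre E k x)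
    (w : Fin k → TangentSpace 𝓘(ℝ, E) x) :
    projMultilinear J x A w = ∑ S : Finset (Fin k), ((1 / 2 : ℂ) ^ k * (-Complex.I) ^ S.card) *
      A (fun i => if i ∈ S then J x (w i) else w i) := by
  simp only [projMultilinear, _root_.sum_apply, _root_.smul_apply, smul_eq_mul,
    ContinuousMultilinearMap.compContinuousLinearMap_apply]
  refine Finset.sum_congr rfl fun S _ => ?_
  congr 1
  change A _ = A _
  congr 1
  funext i
  split_ifs <;> rfl

/-- The component of type `(k, 0)` of a complex valued `k`-form at `x`. -/
def projTypeZero {k : ℕ} (x : M) (A : FormFibre E k x) : FormFibre E k x :=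
  { projMultilinear J x A with
    map_eq_zero_of_eq' := by
      intro w i j hw hij
      change projMultilinear J x A w = 0
      have h1 : projMultilinear J x A w = -projMultilinear J x A w := by
        conv_lhs => rw [projMultilinear_apply]
        rw [projMultilinear_apply, ← Finset.sum_neg_distrib]
        refine Fintype.sum_equiv (Equiv.swap i j).finsetCongr _ _ fun S => ?_
        have h2 : (fun l => if l ∈ (Equiv.swap i j).finsetCongr S then J x (w l) else w l) =
            (fun l => if l ∈ S then J x (w l) else w l) ∘ Equiv.swap i j := by
          funext l
          have h3 : w (Equiv.swap i j l) = w l := by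
            rcases eq_or_ne l i with rfl | hi
            · rw [Equiv.swap_apply_left, hw]
            · rcases eq_or_ne l j with rfl | hj
              · rw [Equiv.swap_apply_right, hw]
              · rw [Equiv.swap_apply_of_ne_of_ne hi hj]
          have h4 : l ∈ (Equiv.swap i j).finsetCongr S ↔ Equiv.swap i j l ∈ S := by
            simp [Equiv.finsetCongr, Finset.mem_map_equiv]
          simp only [Function.comp, h3, h4]
        rw [h2]
        have h5 := A.toAlternatingMap.map_swap (fun l => if l ∈ S then J x (w l) else w l) hij
        have h6 : A ((fun l => if l ∈ S then J x (w l) else w l) ∘ Equiv.swap i j) =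
          -A (fun l => if l ∈ S then J x (w l) else w l) := h5
        rw [h6]
        simp [Equiv.finsetCongr]
      exact self_eq_neg.mp h1 }

/-- The operator `∂̄` on forms of type `(n, 0)`. The `(n, 1)`-form `∂̄ψ = (dψ)^{n,1}` is regarded
as a `(0, 1)`-form with values in the canonical bundle through `α ⊗ φ ↔ α ∧ φ`; its value on the
tangent vector `v` is `dψ(v^{0,1}, ·^{1,0}, …, ·^{1,0})` with `v^{0,1} = (v + i J v) / 2`. -/
def dbarForm {n : ℕ} (ψ : ∀ x : M, FormFibre E n x) (x : M) (v : TangentSpace 𝓘(ℝ, E) x) :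
    FormFibre E n x :=
  let η : E [⋀^Fin (n + 1)]→L[ℝ] ℂ := extDerivAt ψ x
  projTypeZero J x ((1 / 2 : ℂ) • (η.curryLeft v + Complex.I • η.curryLeft (J x v)))

/-- The differential at `x` of a complex valued function on `M`. -/
def diffFun (f : M → ℂ) (x : M) : TangentSpace 𝓘(ℝ, E) x →L[ℝ] ℂ :=
  mfderiv 𝓘(ℝ, E) 𝓘(ℝ, ℂ) f x

/-- The operator `∂̄` on functions: `∂̄f(v) = df(v^{0,1})`. -/
def dbarFun (f : M → ℂ) (x : M) (v : TangentSpace 𝓘(ℝ, E) x) : ℂ :=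
  (1 / 2 : ℂ) * (diffFun f x v + Complex.I * diffFun f x (J x v))

theorem dbarFun_zero (x : M) (v : TangentSpace 𝓘(ℝ, E) x) :
    dbarFun J (fun _ => (0 : ℂ)) x v = 0 := by
  have h : ∀ u : TangentSpace 𝓘(ℝ, E) x, diffFun (fun _ => (0 : ℂ)) x u = 0 := by
    intro u
    rw [diffFun, mfderiv_const]
    rfl
  simp [dbarFun, h]

theorem dbarFun_add {f g : M → ℂ} {x : M} (hf : MDifferentiableAt 𝓘(ℝ, E) 𝓘(ℝ, ℂ) f x)
    (hg : MDifferentiableAt 𝓘(ℝ, E) 𝓘(ℝ, ℂ) g x) (v : TangentSpace 𝓘(ℝ, E) x) :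
    dbarFun J (f + g) x v = dbarFun J f x v + dbarFun J g x v := by
  have h : ∀ u : TangentSpace 𝓘(ℝ, E) x,
      diffFun (f + g) x u = diffFun f x u + diffFun g x u := by
    intro u
    rw [diffFun, mfderiv_add hf hg]
    rfl
  simp only [dbarFun, h]
  ring

theorem dbarFun_const_mul (c : ℂ) {f : M → ℂ} {x : M}
    (hf : MDifferentiableAt 𝓘(ℝ, E) 𝓘(ℝ, ℂ) f x) (v : TangentSpace 𝓘(ℝ, E) x) :
    dbarFun J (fun y => c * f y) x v = c * dbarFun J f x v := by
  have h1 : HasMFDerivAt 𝓘(ℝ, E) 𝓘(ℝ, ℂ) (fun y => c * f y) x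
      (c • (show E →L[ℝ] ℂ from mfderiv 𝓘(ℝ, E) 𝓘(ℝ, ℂ) f x)) :=
    ⟨continuousAt_const.mul hf.continuousAt, hf.hasMFDerivAt.2.const_mul c⟩
  have h : ∀ u : TangentSpace 𝓘(ℝ, E) x,
      diffFun (fun y => c * f y) x u = c * diffFun f x u := by
    intro u
    rw [diffFun, h1.mfderiv]
    rfl
  simp only [dbarFun, h]
  ring

/-- The fibre at `x` of the `m`-th tensor power (over `ℂ`) of the bundle of complex valued
`n`-forms. The fibre at `x` of the `m`-canonical bundle `ω^{⊗m}` is the line in it that is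
spanned by `φ ⊗ … ⊗ φ` for a nonzero `φ` of type `(n, 0)` at `x`, when `dim_ℝ M = 2n`. -/
abbrev TensorFibre (E : Type*) [NormedAddCommGroup E] [NormedSpace ℝ E]
    {M : Type*} [TopologicalSpace M] [ChartedSpace E M] (n m : ℕ) (x : M) : Type _ :=
  PiTensorProduct ℂ (fun _ : Fin m => FormFibre E n x)

/-- The section `ψ ⊗ … ⊗ ψ` (`m` factors). -/
def formPow {n : ℕ} (m : ℕ) (ψ : ∀ x : M, FormFibre E n x) (x : M) : TensorFibre E n m x :=
  PiTensorProduct.tprod ℂ (fun _ : Fin m => ψ x)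

/-- `∂̄(ψ ⊗ … ⊗ ψ) = ∑ᵢ ψ ⊗ … ⊗ ∂̄ψ ⊗ … ⊗ ψ`, with `∂̄ψ` in the `i`-th place, evaluated on `v`. -/
def dbarFormPow {n : ℕ} (m : ℕ) (ψ : ∀ x : M, FormFibre E n x) (x : M)
    (v : TangentSpace 𝓘(ℝ, E) x) : TensorFibre E n m x :=
  ∑ i : Fin m, PiTensorProduct.tprod ℂ
    (Function.update (fun _ : Fin m => ψ x) i (dbarForm J ψ x v))

/-- `ψ` is a local smooth frame over `U` of the canonical bundle of `(M, J)`, `dim_ℝ M = 2n`: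
a smooth nowhere vanishing form of type `(n, 0)` on `U`. -/
structure IsCanonicalFrameOn {n : ℕ} (ψ : ∀ x : M, FormFibre E n x) (U : Set M) : Prop where
  smooth : IsSmoothFormOn ψ U
  type_zero : ∀ x ∈ U, IsTypeZero J x (ψ x)
  ne_zero : ∀ x ∈ U, ψ x ≠ 0

/-- The section `σ` of `ω^{⊗m}` is smooth and satisfies `∂̄σ = 0` on `U`, expressed in the frame
`ψ`: `σ = f · ψ^{⊗m}` with `f` smooth, and `∂̄f ⊗ ψ^{⊗m} + f · ∂̄(ψ^{⊗m}) = 0`. -/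
def IsPseudoholomorphicInFrame {n m : ℕ} (ψ : ∀ x : M, FormFibre E n x) (U : Set M)
    (σ : ∀ x : M, TensorFibre E n m x) : Prop :=
  ∃ f : M → ℂ, ContMDiffOn 𝓘(ℝ, E) 𝓘(ℝ, ℂ) ∞ f U ∧ ∀ x ∈ U,
    σ x = f x • formPow m ψ x ∧
    ∀ v : TangentSpace 𝓘(ℝ, E) x,
      dbarFun J f x v • formPow m ψ x + f x • dbarFormPow J m ψ x v = 0

/-- The complex vector space `H⁰(X, ω_X^{⊗m})` of pseudoholomorphic `m`-canonical sections of the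
almost complex manifold `X = (M, J)` of complex dimension `n`: sections of `ω_X^{⊗m}` which are
smooth and killed by `∂̄`, in terms of every local frame of the canonical bundle. -/
def pluricanonicalSections (n m : ℕ) : Submodule ℂ (∀ x : M, TensorFibre E n m x) where
  carrier := {σ | ∀ (U : Set M) (ψ : ∀ x : M, FormFibre E n x), IsOpen U →
    IsCanonicalFrameOn J ψ U → IsPseudoholomorphicInFrame J ψ U σ}
  zero_mem' := by
    intro U ψ _ _
    refine ⟨fun _ => 0, contMDiffOn_const, fun x _ => ⟨by simp, fun v => ?_⟩⟩
    rw [dbarFun_zero, zero_smul, zero_smul, add_zero]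
  add_mem' := by
    intro σ τ hσ hτ U ψ hU hψ
    obtain ⟨f, hf, hf'⟩ := hσ U ψ hU hψ
    obtain ⟨g, hg, hg'⟩ := hτ U ψ hU hψ
    refine ⟨f + g, hf.add hg, fun x hx => ⟨?_, fun v => ?_⟩⟩
    · rw [Pi.add_apply, Pi.add_apply, (hf' x hx).1, (hg' x hx).1, add_smul]
    · rw [dbarFun_add J ((hf.contMDiffAt (hU.mem_nhds hx)).mdifferentiableAt (by simp))
        ((hg.contMDiffAt (hU.mem_nhds hx)).mdifferentiableAt (by simp)),
        Pi.add_apply, add_smul, add_smul, add_add_add_comm, (hf' x hx).2 v, (hg' x hx).2 v,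
        add_zero]
  smul_mem' := by
    intro c σ hσ U ψ hU hψ
    obtain ⟨f, hf, hf'⟩ := hσ U ψ hU hψ
    refine ⟨fun x => c * f x, ?_, fun x hx => ⟨?_, fun v => ?_⟩⟩
    · exact ((contDiff_const (c := c)).mul contDiff_id).contMDiff.comp_contMDiffOn hf
    · rw [Pi.smul_apply, (hf' x hx).1, smul_smul]
    · rw [dbarFun_const_mul J c ((hf.contMDiffAt (hU.mem_nhds hx)).mdifferentiableAt (by simp)),
        mul_smul, mul_smul, ← smul_add, (hf' x hx).2 v, smul_zero]

/-- The `m`-th plurigenus of the almost complex manifold `(M, J)` of complex dimension `n`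
(meaningful when `H⁰(X, ω_X^{⊗m})` is finite dimensional, as it is on compact manifolds). -/
def plurigenus (n m : ℕ) : ℕ := Module.finrank ℂ (pluricanonicalSections J n m)

open Classical in
/-- The Kodaira dimension of the almost complex manifold `(M, J)` of complex dimension `n`:
`-∞` if all plurigenera with `m ≥ 1` vanish, `limsup_m log P_m / log m` otherwise
(with `log 0 = -∞`). -/
def kodairaDim (n : ℕ) : EReal :=
  if ∀ m : ℕ, 1 ≤ m → plurigenus J n m = 0 then ⊥
  else Filter.limsup
    (fun m : ℕ => ENNReal.log (plurigenus J n m : ENNReal) / ((Real.log m : ℝ) : EReal))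
    Filter.atTop

end Forms

end AlmostComplex

/-! ## The Kodaira–Thurston manifold -/

namespace KodairaThurston

/-- The matrix with coordinates `p = (x, y, z, t)`. -/
def mat (p : Fin 4 → ℝ) : Matrix (Fin 5) (Fin 5) ℝ :=
  !![1, p 0, p 2, 0, 0;
     0, 1, p 1, 0, 0;
     0, 0, 1, 0, 0;
     0, 0, 0, 1, p 3;
     0, 0, 0, 0, 1]

theorem det_mat (p : Fin 4 → ℝ) : (mat p).det = 1 := by
  simp [mat, Matrix.det_succ_row_zero, Fin.sum_univ_succ, Fin.succAbove]

/-- The coordinates `(x, y, z, t)` of the product of two matrices. -/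
def coordMul (p q : Fin 4 → ℝ) : Fin 4 → ℝ :=
  ![p 0 + q 0, p 1 + q 1, p 2 + q 2 + p 0 * q 1, p 3 + q 3]

theorem mat_mul (p q : Fin 4 → ℝ) : mat p * mat q = mat (coordMul p q) := by
  ext i j
  fin_cases i <;> fin_cases j <;>
    simp [mat, coordMul, Matrix.mul_apply, Fin.sum_univ_succ] <;> ring

theorem mat_zero : mat 0 = 1 := by
  ext i j
  fin_cases i <;> fin_cases j <;> simp [mat]

theorem mat_injective : Function.Injective mat := by
  intro p q h
  funext i
  fin_cases i
  · simpa [mat] using congrFun (congrFun h 0) 1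
  · simpa [mat] using congrFun (congrFun h 1) 2
  · simpa [mat] using congrFun (congrFun h 0) 2
  · simpa [mat] using congrFun (congrFun h 3) 4

/-- The coordinates of the inverse matrix. -/
def coordInv (p : Fin 4 → ℝ) : Fin 4 → ℝ := ![-p 0, -p 1, -p 2 + p 0 * p 1, -p 3]

theorem coordMul_coordInv (p : Fin 4 → ℝ) : coordMul p (coordInv p) = 0 := by
  funext i
  fin_cases i <;> simp [coordMul, coordInv]

/-- The matrix with coordinates `p` as an element of `SL(5, ℝ)`. -/
def matSL (p : Fin 4 → ℝ) : Matrix.SpecialLinearGroup (Fin 5) ℝ := ⟨mat p, det_mat p⟩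

theorem matSL_mul (p q : Fin 4 → ℝ) : matSL p * matSL q = matSL (coordMul p q) :=
  Subtype.ext (mat_mul p q)

theorem matSL_zero : matSL 0 = 1 := Subtype.ext mat_zero

theorem matSL_inv (p : Fin 4 → ℝ) : (matSL p)⁻¹ = matSL (coordInv p) :=
  inv_eq_of_mul_eq_one_right (by rw [matSL_mul, coordMul_coordInv, matSL_zero])

/-- The Lie group `G` of all matrices `mat (x, y, z, t)`. -/
def G : Subgroup (Matrix.SpecialLinearGroup (Fin 5) ℝ) where
  carrier := range matSL
  mul_mem' := by
    rintro _ _ ⟨p, rfl⟩ ⟨q, rfl⟩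
    exact ⟨_, (matSL_mul p q).symm⟩
  one_mem' := ⟨0, matSL_zero⟩
  inv_mem' := by
    rintro _ ⟨p, rfl⟩
    exact ⟨_, (matSL_inv p).symm⟩

/-- The element of `G` with coordinates `p = (x, y, z, t)`. -/
def toG (p : Fin 4 → ℝ) : G := ⟨matSL p, p, rfl⟩

theorem toG_mul (p q : Fin 4 → ℝ) : toG p * toG q = toG (coordMul p q) :=
  Subtype.ext (matSL_mul p q)

theorem toG_inv (p : Fin 4 → ℝ) : (toG p)⁻¹ = toG (coordInv p) := Subtype.ext (matSL_inv p)

theorem toG_zero : toG 0 = 1 := Subtype.ext matSL_zero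

theorem toG_surjective : Function.Surjective toG := by
  rintro ⟨_, p, rfl⟩
  exact ⟨p, rfl⟩

theorem toG_injective : Function.Injective toG := by
  intro p q h
  exact mat_injective (congrArg (fun g : G => (g.1.1 : Matrix (Fin 5) (Fin 5) ℝ)) h)

/-- A matrix with integral entries. -/
def IsIntegral (g : G) : Prop :=
  ∀ i j, ∃ k : ℤ, (g.1.1 : Matrix (Fin 5) (Fin 5) ℝ) i j = k

theorem isIntegral_toG_iff (p : Fin 4 → ℝ) :
    IsIntegral (toG p) ↔ ∀ i, ∃ k : ℤ, p i = k := by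
  constructor
  · intro h i
    fin_cases i
    · simpa [toG, matSL, mat] using h 0 1
    · simpa [toG, matSL, mat] using h 1 2
    · simpa [toG, matSL, mat] using h 0 2
    · simpa [toG, matSL, mat] using h 3 4
  · intro h i j
    have h0 : ∃ k : ℤ, (0 : ℝ) = k := ⟨0, by simp⟩
    have h1 : ∃ k : ℤ, (1 : ℝ) = k := ⟨1, by simp⟩
    fin_cases i <;> fin_cases j <;>
      first
        | exact h 0 | exact h 1 | exact h 2 | exact h 3 | exact h0 | exact h1

/-- The lattice `Γ` of matrices in `G` with integral entries. -/
def Γ : Subgroup G where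
  carrier := {g | IsIntegral g}
  mul_mem' := by
    intro a b ha hb
    obtain ⟨p, rfl⟩ := toG_surjective a
    obtain ⟨q, rfl⟩ := toG_surjective b
    have ha' := (isIntegral_toG_iff p).1 ha
    have hb' := (isIntegral_toG_iff q).1 hb
    choose m hm using ha'
    choose n hn using hb'
    change IsIntegral _
    rw [toG_mul, isIntegral_toG_iff]
    intro i
    fin_cases i
    · exact ⟨m 0 + n 0, by simp [coordMul, hm, hn]⟩
    · exact ⟨m 1 + n 1, by simp [coordMul, hm, hn]⟩
    · exact ⟨m 2 + n 2 + m 0 * n 1, by simp [coordMul, hm, hn]⟩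
    · exact ⟨m 3 + n 3, by simp [coordMul, hm, hn]⟩
  one_mem' := by
    change IsIntegral _
    rw [← toG_zero, isIntegral_toG_iff]
    exact fun _ => ⟨0, by simp⟩
  inv_mem' := by
    intro a ha
    obtain ⟨p, rfl⟩ := toG_surjective a
    have ha' := (isIntegral_toG_iff p).1 ha
    choose m hm using ha'
    change IsIntegral _
    rw [toG_inv, isIntegral_toG_iff]
    intro i
    fin_cases i
    · exact ⟨-m 0, by simp [coordInv, hm]⟩
    · exact ⟨-m 1, by simp [coordInv, hm]⟩
    · exact ⟨-m 2 + m 0 * m 1, by simp [coordInv, hm]⟩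
    · exact ⟨-m 3, by simp [coordInv, hm]⟩

/-- The Kodaira–Thurston manifold `M = Γ \ G`, the quotient of `G` by left multiplication by
elements of `Γ`, with the quotient topology. -/
def KT : Type := Quotient (MulAction.orbitRel Γ G)

instance : TopologicalSpace KT :=
  inferInstanceAs (TopologicalSpace (Quotient (MulAction.orbitRel Γ G)))

/-- The covering `ℝ⁴ ≅ G → Γ \ G`. -/
def proj (p : Fin 4 → ℝ) : KT := Quotient.mk (MulAction.orbitRel Γ G) (toG p)

theorem proj_surjective : Function.Surjective proj := by
  intro m
  obtain ⟨g, rfl⟩ := Quotient.exists_rep m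
  obtain ⟨p, rfl⟩ := toG_surjective g
  exact ⟨p, rfl⟩

theorem proj_eq_iff (p q : Fin 4 → ℝ) :
    proj p = proj q ↔ ∃ k : Fin 4 → ℤ, p = coordMul (fun i => (k i : ℝ)) q := by
  have h : proj p = proj q ↔ toG p ∈ MulAction.orbit Γ (toG q) :=
    Quotient.eq (r := MulAction.orbitRel Γ G)
  rw [h]
  constructor
  · rintro ⟨⟨g, hg⟩, hgq⟩
    obtain ⟨r, rfl⟩ := toG_surjective g
    obtain ⟨k, hk⟩ := Classical.axiomOfChoice ((isIntegral_toG_iff r).1 hg)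
    refine ⟨k, toG_injective ?_⟩
    have h1 : toG r * toG q = toG p := hgq
    rw [← h1, toG_mul]
    congr 2
    funext i
    exact hk i
  · rintro ⟨k, rfl⟩
    refine ⟨⟨toG (fun i => (k i : ℝ)), (isIntegral_toG_iff _).2 fun i => ⟨k i, rfl⟩⟩, ?_⟩
    exact toG_mul _ _

theorem continuous_toG : Continuous toG := by
  refine Continuous.subtype_mk (Continuous.subtype_mk ?_ _) _
  refine continuous_matrix fun i j => ?_
  fin_cases i <;> fin_cases j <;> simp [mat] <;> fun_prop

/-- The coordinates `(x, y, z, t)` of an element of `G`. -/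
def coords (g : G) : Fin 4 → ℝ := ![g.1.1 0 1, g.1.1 1 2, g.1.1 0 2, g.1.1 3 4]

theorem continuous_coords : Continuous coords := by
  have h : ∀ i j, Continuous (fun g : G => (g.1.1 : Matrix (Fin 5) (Fin 5) ℝ) i j) := fun i j =>
    (continuous_id.matrix_elem i j).comp (continuous_subtype_val.comp continuous_subtype_val)
  refine continuous_pi fun i => ?_
  fin_cases i
  · exact h 0 1
  · exact h 1 2
  · exact h 0 2
  · exact h 3 4

theorem coords_toG (p : Fin 4 → ℝ) : coords (toG p) = p := by
  funext i
  fin_cases i <;> simp [coords, toG, matSL, mat]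

theorem toG_coords (g : G) : toG (coords g) = g := by
  obtain ⟨p, rfl⟩ := toG_surjective g
  rw [coords_toG]

/-- The global chart `(x, y, z, t)` of `G`. -/
def homeoG : (Fin 4 → ℝ) ≃ₜ G where
  toFun := toG
  invFun := coords
  left_inv := coords_toG
  right_inv := toG_coords
  continuous_toFun := continuous_toG
  continuous_invFun := continuous_coords

theorem continuous_proj : Continuous proj :=
  (continuous_quot_mk (r := (MulAction.orbitRel Γ G).r)).comp continuous_toG

theorem isOpenMap_proj : IsOpenMap proj :=
  (isOpenMap_quotient_mk'_mul (Γ := Γ) (T := G)).comp homeoG.isOpenMap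

/-- The projection is injective on the unit cube with centre `c`. -/
theorem injOn_proj (c : Fin 4 → ℝ) : InjOn proj (Metric.ball c (1 / 2)) := by
  intro p hp q hq h
  obtain ⟨k, rfl⟩ := (proj_eq_iff p q).1 h
  rw [Metric.mem_ball, dist_pi_lt_iff (by norm_num)] at hp hq
  have key : ∀ i : Fin 4, |coordMul (fun i => (k i : ℝ)) q i - q i| < 1 := by
    intro i
    have h1 := hp i
    have h2 := hq i
    rw [Real.dist_eq, abs_lt] at h1 h2
    rw [abs_lt]
    constructor <;> linarith [h1.1, h1.2, h2.1, h2.2]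
  have hk : ∀ a : ℤ, |(a : ℝ)| < 1 → a = 0 := by
    intro a ha
    have : |a| < 1 := by exact_mod_cast ha
    exact Int.abs_lt_one_iff.1 this
  have k0 : k 0 = 0 := hk _ (by simpa [coordMul] using key 0)
  have k1 : k 1 = 0 := hk _ (by simpa [coordMul] using key 1)
  have k2 : k 2 = 0 := hk _ (by simpa [coordMul, k0] using key 2)
  have k3 : k 3 = 0 := hk _ (by simpa [coordMul] using key 3)
  funext i
  fin_cases i <;> simp [coordMul, k0, k1, k2, k3]

/-- The chart of `M` given by the coordinates `(x, y, z, t)` in the unit cube with centre `c`. -/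
def chart (c : Fin 4 → ℝ) : OpenPartialHomeomorph KT (Fin 4 → ℝ) :=
  (OpenPartialHomeomorph.ofContinuousOpen ((injOn_proj c).toPartialEquiv proj (Metric.ball c (1 / 2)))
    continuous_proj.continuousOn isOpenMap_proj Metric.isOpen_ball).symm

theorem chart_symm_apply (c p : Fin 4 → ℝ) : (chart c).symm p = proj p := rfl

theorem chart_target (c : Fin 4 → ℝ) : (chart c).target = Metric.ball c (1 / 2) := rfl

theorem chart_source (c : Fin 4 → ℝ) : (chart c).source = proj '' Metric.ball c (1 / 2) := rfl

theorem proj_chart (c : Fin 4 → ℝ) {m : KT} (hm : m ∈ (chart c).source) :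
    proj (chart c m) = m := (chart c).left_inv hm

/-- A point of `G`, in coordinates, above the given point of `M`. -/
def lift (m : KT) : Fin 4 → ℝ := (proj_surjective m).choose

theorem proj_lift (m : KT) : proj (lift m) = m := (proj_surjective m).choose_spec

instance : ChartedSpace (Fin 4 → ℝ) KT where
  atlas := range chart
  chartAt m := chart (lift m)
  mem_chart_source m := by
    rw [chart_source]
    exact ⟨lift m, Metric.mem_ball_self (by norm_num), proj_lift m⟩
  chart_mem_atlas m := ⟨lift m, rfl⟩

/-- Integer valued functions which are continuous within a set at a point are constant near it. -/
theorem eventually_eq_of_int {s : Set (Fin 4 → ℝ)} {p : Fin 4 → ℝ} {g : (Fin 4 → ℝ) → ℝ}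
    (hg : ContinuousWithinAt g s p) (hint : ∀ q ∈ s, ∃ a : ℤ, g q = a) (hp : p ∈ s) :
    ∀ᶠ q in 𝓝[s] p, g q = g p := by
  have h := hg.eventually (Metric.ball_mem_nhds (g p) one_pos)
  filter_upwards [h, self_mem_nhdsWithin] with q hq hqs
  obtain ⟨a, ha⟩ := hint q hqs
  obtain ⟨b, hb⟩ := hint p hp
  change dist (g q) (g p) < 1 at hq
  rw [Real.dist_eq, ha, hb] at hq
  have h1 : |a - b| < 1 := by exact_mod_cast hq
  have h2 := Int.abs_lt_one_iff.1 h1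
  rw [ha, hb]
  exact_mod_cast sub_eq_zero.1 h2

instance : IsManifold 𝓘(ℝ, Fin 4 → ℝ) ∞ KT := by
  refine isManifold_of_contDiffOn _ _ _ ?_
  rintro _ _ ⟨c, rfl⟩ ⟨d, rfl⟩
  set e : OpenPartialHomeomorph (Fin 4 → ℝ) (Fin 4 → ℝ) := (chart c).symm.trans (chart d) with he
  have hcont : ContinuousOn e e.source := e.continuousOn
  have hk : ∀ q ∈ e.source, ∃ k : Fin 4 → ℤ, e q = coordMul (fun i => (k i : ℝ)) q := by
    intro q hq
    rw [← proj_eq_iff]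
    rw [he, OpenPartialHomeomorph.trans_source] at hq
    exact proj_chart d hq.2
  have main : ContDiffOn ℝ ∞ e e.source := by
    intro p hp
    have hc : ∀ i, ContinuousWithinAt (fun q => e q i) e.source p := fun i =>
      (continuous_apply i).continuousAt.comp_continuousWithinAt (hcont p hp)
    have hid : ∀ i, ContinuousWithinAt (fun q : Fin 4 → ℝ => q i) e.source p := fun i =>
      (continuous_apply i).continuousWithinAt
    have e0 := eventually_eq_of_int ((hc 0).sub (hid 0)) (by
      intro q hq
      obtain ⟨k, hk⟩ := hk q hq
      exact ⟨k 0, by simp [hk, coordMul]⟩) hp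
    have e1 := eventually_eq_of_int ((hc 1).sub (hid 1)) (by
      intro q hq
      obtain ⟨k, hk⟩ := hk q hq
      exact ⟨k 1, by simp [hk, coordMul]⟩) hp
    have e2 := eventually_eq_of_int
      (((hc 2).sub (hid 2)).sub (((hc 0).sub (hid 0)).mul (hid 1))) (by
      intro q hq
      obtain ⟨k, hk⟩ := hk q hq
      exact ⟨k 2, by simp [hk, coordMul]; ring⟩) hp
    have e3 := eventually_eq_of_int ((hc 3).sub (hid 3)) (by
      intro q hq
      obtain ⟨k, hk⟩ := hk q hq
      exact ⟨k 3, by simp [hk, coordMul]⟩) hp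
    obtain ⟨k, hkp⟩ := hk p hp
    have hev : e =ᶠ[𝓝[e.source] p] coordMul (fun i => (k i : ℝ)) := by
      filter_upwards [e0, e1, e2, e3] with q h0 h1 h2 h3
      simp only [Pi.sub_apply, Pi.mul_apply] at h0 h1 h2 h3
      simp only [hkp, coordMul] at h0 h1 h2 h3
      simp at h0 h1 h2 h3
      funext i
      fin_cases i
      · simp [coordMul]; linarith
      · simp [coordMul]; linarith
      · simp [coordMul]
        rw [h0] at h2
        linarith
      · simp [coordMul]; linarith
    have hsm : ContDiff ℝ ∞ (coordMul (fun i => (k i : ℝ))) := by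
      rw [contDiff_pi]
      intro i
      fin_cases i <;> simp [coordMul] <;> fun_prop
    exact hsm.contDiffWithinAt.congr_of_eventuallyEq hev (hev.eq_of_nhdsWithin hp)
  simpa using main

/-! ### The frame and the almost complex structure on `M × Δ` -/

/-- The left invariant vector fields `e₁ = ∂_t`, `e₂ = ∂_x`, `e₃ = ∂_y + x ∂_z`, `e₄ = ∂_z` on `G`,
in the coordinates `(x, y, z, t)`. -/
def field (i : Fin 4) (p : Fin 4 → ℝ) : Fin 4 → ℝ :=
  (![![0, 0, 0, 1], ![1, 0, 0, 0], ![0, 1, p 0, 0], ![0, 0, 1, 0]] : Fin 4 → Fin 4 → ℝ) i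

/-- The vector fields induced by `e₁, …, e₄` on `M`. The tangent space of `M` at `m` is identified
with `ℝ⁴` by the chart at `m`, whose values are the coordinates `(x, y, z, t)` near `lift m`. -/
def frame (i : Fin 4) (m : KT) : TangentSpace 𝓘(ℝ, Fin 4 → ℝ) m := field i (lift m)

/-- The disc `Δ = {t : |t| < π}`. -/
def Δ : TopologicalSpace.Opens ℂ := ⟨Metric.ball 0 Real.pi, Metric.isOpen_ball⟩

/-- The standard complex structure on `Δ`. -/
def stdJ (t : Δ) : TangentSpace 𝓘(ℝ, ℂ) t →L[ℝ] TangentSpace 𝓘(ℝ, ℂ) t :=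
  (Complex.I • ContinuousLinearMap.id ℝ ℂ : ℂ →L[ℝ] ℂ)

/-- The global frame `e₁, …, e₆` of `M × Δ`; here `e₅` and `e₆` are the derivatives with respect to
the real and to the imaginary part of the coordinate of `Δ`. -/
def totalFrame (x : KT × Δ) :
    Fin 6 → TangentSpace (𝓘(ℝ, Fin 4 → ℝ).prod 𝓘(ℝ, ℂ)) x :=
  (![(field 0 (lift x.1), 0), (field 1 (lift x.1), 0), (field 2 (lift x.1), 0),
    (field 3 (lift x.1), 0), (0, 1), (0, Complex.I)] : Fin 6 → (Fin 4 → ℝ) × ℂ)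

theorem linearIndependent_totalFrame (x : KT × Δ) : LinearIndependent ℝ (totalFrame x) := by
  change LinearIndependent ℝ
    (![(field 0 (lift x.1), 0), (field 1 (lift x.1), 0), (field 2 (lift x.1), 0),
    (field 3 (lift x.1), 0), (0, 1), (0, Complex.I)] : Fin 6 → (Fin 4 → ℝ) × ℂ)
  rw [Fintype.linearIndependent_iff]
  intro g hg
  have h1 := congrArg Prod.fst hg
  have h2 := congrArg Prod.snd hg
  have h10 := congrFun h1 0
  have h11 := congrFun h1 1
  have h12 := congrFun h1 2
  have h13 := congrFun h1 3
  have h2r := congrArg Complex.re h2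
  have h2i := congrArg Complex.im h2
  simp [Fin.sum_univ_succ, field] at h10 h11 h12 h13 h2r h2i
  intro i
  fin_cases i
  · simpa using h13
  · simpa using h10
  · simpa using h11
  · have : g 2 = 0 := by simpa using h11
    simpa [this] using h12
  · simpa using h2r
  · simpa using h2i

/-- The global frame as a basis of the tangent space of `M × Δ` at `x`. -/
def totalBasis (x : KT × Δ) :
    Module.Basis (Fin 6) ℝ (TangentSpace (𝓘(ℝ, Fin 4 → ℝ).prod 𝓘(ℝ, ℂ)) x) :=
  basisOfLinearIndependentOfCardEqFinrank (linearIndependent_totalFrame x) (by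
    change Fintype.card (Fin 6) = Module.finrank ℝ ((Fin 4 → ℝ) × ℂ)
    simp)

theorem coe_totalBasis (x : KT × Δ) : ⇑(totalBasis x) = totalFrame x :=
  coe_basisOfLinearIndependentOfCardEqFinrank _ _

/-- The matrix of `J` at a point over `t ∈ Δ`. -/
def matrixJ (t : ℂ) : Matrix (Fin 6) (Fin 6) ℝ :=
  !![0, -1, 0, 0, 0, 0;
     1, 0, 0, 0, 0, 0;
     0, 0, -(t.im / (t.re + Real.pi)), -(‖t + Real.pi‖ ^ 2 / (t.re + Real.pi)), 0, 0;
     0, 0, 1 / (t.re + Real.pi), t.im / (t.re + Real.pi), 0, 0;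
     0, 0, 0, 0, 0, -1;
     0, 0, 0, 0, 1, 0]

instance (x : KT × Δ) :
    FiniteDimensional ℝ (TangentSpace (𝓘(ℝ, Fin 4 → ℝ).prod 𝓘(ℝ, ℂ)) x) :=
  inferInstanceAs (FiniteDimensional ℝ ((Fin 4 → ℝ) × ℂ))

instance (x : KT × Δ) : T2Space (TangentSpace (𝓘(ℝ, Fin 4 → ℝ).prod 𝓘(ℝ, ℂ)) x) :=
  inferInstanceAs (T2Space ((Fin 4 → ℝ) × ℂ))

/-- The almost complex structure `J` on `M × Δ`. -/
def totalJ (x : KT × Δ) :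
    TangentSpace (𝓘(ℝ, Fin 4 → ℝ).prod 𝓘(ℝ, ℂ)) x →L[ℝ]
      TangentSpace (𝓘(ℝ, Fin 4 → ℝ).prod 𝓘(ℝ, ℂ)) x :=
  LinearMap.toContinuousLinearMap (Matrix.toLin (totalBasis x) (totalBasis x) (matrixJ x.2))

/-- The inclusion of the fibre `M_t = M × {t}`. -/
def fibreIncl (t : Δ) (m : KT) : KT × Δ := (m, t)

/-- The almost complex structure `J_t` on the fibre `M_t`, as a structure on `M`: the restriction
of `J` to `T(M × {t})`, followed by the differential of the projection to `M`. -/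
def fibreJ (t : Δ) (m : KT) :
    TangentSpace 𝓘(ℝ, Fin 4 → ℝ) m →L[ℝ] TangentSpace 𝓘(ℝ, Fin 4 → ℝ) m :=
  (mfderiv (𝓘(ℝ, Fin 4 → ℝ).prod 𝓘(ℝ, ℂ)) 𝓘(ℝ, Fin 4 → ℝ) Prod.fst (fibreIncl t m)).comp
    ((totalJ (fibreIncl t m)).comp
      (mfderiv 𝓘(ℝ, Fin 4 → ℝ) (𝓘(ℝ, Fin 4 → ℝ).prod 𝓘(ℝ, ℂ)) (fibreIncl t) m))

/-- A real number of absolute value less than `π` as a point of `Δ`. -/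
def realPoint (s : Ioo (-Real.pi) Real.pi) : Δ :=
  ⟨((s : ℝ) : ℂ), by
    change ((s : ℝ) : ℂ) ∈ Metric.ball (0 : ℂ) Real.pi
    rw [mem_ball_zero_iff, Complex.norm_real, Real.norm_eq_abs, abs_lt]
    exact s.2⟩

/-- The set `π ℚ` of rational multiples of `π`. -/
def piRat : Set ℝ := {s | ∃ q : ℚ, s = Real.pi * q}

/-- The `m`-th plurigenus of the fibre `M_t`. -/
def fibrePlurigenus (m : ℕ) (t : Δ) : ℕ := AlmostComplex.plurigenus (fibreJ t) 2 m

/-- The Kodaira dimension of the fibre `M_t`. -/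
def fibreKod (t : Δ) : EReal := AlmostComplex.kodairaDim (fibreJ t) 2

end KodairaThurston

end

/-!
The covectors `φ₁ = e¹ + i e²` and `φ₂ = e³ + κ e⁴`, for a suitable constant `κ` depending on `t`,
are of type `(1, 0)` on the fibre over `t`. Hence `φ₁ ∧ φ₂` is a global frame of the canonical
bundle, and `∂̄(φ₁ ∧ φ₂) = c φ̄₁ ⊗ (φ₁ ∧ φ₂)` with `c = |t + π|² / (4 (Re t + π))`. A `k`-canonical
section is therefore `f (φ₁ ∧ φ₂)^k` with `∂̄f + k c f φ̄₁ = 0`. On the universal cover `G = ℝ⁴`,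
multiplication by `exp (-2ikcx)` turns `f` into a bounded function killed by `∂̄`, which is constant
by Liouville's theorem along pseudoholomorphic planes. So `f = a exp (2ikcx)`, and this descends to
`M` exactly when `kc ∈ πℤ`: the plurigenus `P_k` is the indicator function of the closed condition
`kc ∈ πℤ` on `t`. For real `t` one has `c = (t + π) / 4`, so that some `P_k` with `k ≥ 1` is nonzero
exactly when `t ∈ πℚ`, and then infinitely many are. Since `πℚ` and its complement are dense in `ℝ`,
the Kodaira dimension is not semicontinuous.
-/

namespace AlmostComplex

section TangentEndomorphism

variable {E : Type*} [NormedAddCommGroup E] [NormedSpace ℝ E]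
  {H : Type*} [TopologicalSpace H] {I : ModelWithCorners ℝ E H}
  {M : Type*} [TopologicalSpace M] [ChartedSpace H M] [IsManifold I 1 M]

theorem trivializationAt_snd {x₀ x : M} (hx : x ∈ (chartAt H x₀).source)
    (v : TangentSpace I x) :
    (trivializationAt E (TangentSpace I) x₀ ⟨x, v⟩).2 =
      mfderiv I 𝓘(ℝ, E) (extChartAt I x₀) x v := by
  have hmem : x ∈ (trivializationAt E (TangentSpace I) x₀).baseSet := by
    rwa [TangentBundle.trivializationAt_baseSet]
  exact (Bundle.Trivialization.continuousLinearMapAt_apply_of_mem (R := ℝ) _ hmem v).symm.trans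
    (DFunLike.congr_fun (TangentBundle.continuousLinearMapAt_trivializationAt hx) v)

theorem contMDiff_tangentBundle_of_mfderiv_extChartAt
    {T : ∀ x : M, TangentSpace I x → TangentSpace I x} {a : M → E × E → E}
    (ha : ∀ x v, ContDiffAt ℝ ∞ (a x) (extChartAt I x x, v))
    (hT : ∀ x₀, ∀ᶠ x in 𝓝 x₀, ∀ v, mfderiv I 𝓘(ℝ, E) (extChartAt I x₀) x (T x v) =
      a x₀ (extChartAt I x₀ x, mfderiv I 𝓘(ℝ, E) (extChartAt I x₀) x v)) :
    ContMDiff I.tangent I.tangent ∞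
      (fun v : TangentBundle I M => (⟨v.1, T v.1 v.2⟩ : TangentBundle I M)) := by
  intro v₀
  have hbase : ContMDiffAt I.tangent I ∞ (fun v : TangentBundle I M => v.1) v₀ :=
    Bundle.contMDiff_proj _ v₀
  have hpoint : ContMDiffAt I.tangent 𝓘(ℝ, E) ∞
      (fun v : TangentBundle I M => extChartAt I v₀.1 v.1) v₀ :=
    contMDiffAt_extChartAt.comp v₀ hbase
  have hvector : ContMDiffAt I.tangent 𝓘(ℝ, E) ∞
      (fun v => (trivializationAt E (TangentSpace I) v₀.1 v).2) v₀ :=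
    ((Bundle.contMDiffAt_totalSpace).1 contMDiffAt_id).2
  refine (Bundle.contMDiffAt_totalSpace).2 ⟨hbase, ?_⟩
  have hsmooth := ContDiffAt.comp_contMDiffAt (x := v₀) (by exact ha v₀.1 _)
    (hpoint.prodMk_space hvector)
  refine hsmooth.congr_of_eventuallyEq ?_
  filter_upwards [hbase.continuousAt.eventually (hT v₀.1), hbase.continuousAt.eventually
    ((chartAt H v₀.1).open_source.mem_nhds (mem_chart_source H v₀.1))] with v hv hsource
  rw [Function.comp_apply, trivializationAt_snd hsource, hv, ← trivializationAt_snd hsource]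

end TangentEndomorphism

/-- Liouville's theorem for the restriction of `F` to the plane through `p` spanned by `u` and `v`,
with the complex structure that maps `u` to `v`. -/
theorem apply_add_eq_of_isBounded_range {E : Type*} [NormedAddCommGroup E] [NormedSpace ℝ E]
    {F : E → ℂ} (hF : Differentiable ℝ F) (hbounded : Bornology.IsBounded (range F)) {p u v : E}
    (huv : ∀ a b : ℝ, fderiv ℝ F (p + a • u + b • v) v =
      Complex.I * fderiv ℝ F (p + a • u + b • v) u) (a b : ℝ) :
    F (p + a • u + b • v) = F p := by
  let plane : ℂ → E := fun z => p + z.re • u + z.im • v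
  have hplane : ∀ z, HasFDerivAt plane
      (Complex.reCLM.smulRight u + Complex.imCLM.smulRight v) z := fun z =>
    ((Complex.reCLM.hasFDerivAt.smul_const u).const_add p).add
      (Complex.imCLM.hasFDerivAt.smul_const v)
  have hcomp : ∀ z, HasFDerivAt (F ∘ plane) ((fderiv ℝ F (plane z)).comp
      (Complex.reCLM.smulRight u + Complex.imCLM.smulRight v)) z := fun z =>
    (hF _).hasFDerivAt.comp z (hplane z)
  have hholomorphic : Differentiable ℂ (F ∘ plane) := by
    intro z
    refine differentiableAt_complex_iff_differentiableAt_real.2 ⟨(hcomp z).differentiableAt, ?_⟩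
    rw [(hcomp z).fderiv]
    simpa using huv z.re z.im
  simpa [plane] using hholomorphic.apply_eq_apply_of_bounded
    (hbounded.subset (range_comp_subset_range plane F)) ⟨a, b⟩ 0

variable {E : Type*} [NormedAddCommGroup E] [NormedSpace ℝ E]
  {M : Type*} [TopologicalSpace M] [ChartedSpace E M]
  {J : ∀ x : M, TangentSpace 𝓘(ℝ, E) x →L[ℝ] TangentSpace 𝓘(ℝ, E) x}
  {k n m : ℕ} {x : M} {U : Set M}

section TypeZero

variable {A : FormFibre E k x}

theorem projTypeZero_apply (A : FormFibre E k x) (w : Fin k → TangentSpace 𝓘(ℝ, E) x) :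
    projTypeZero J x A w = ∑ S : Finset (Fin k), ((1 / 2 : ℂ) ^ k * (-Complex.I) ^ S.card) *
      A (fun i => if i ∈ S then J x (w i) else w i) :=
  projMultilinear_apply J x A w

theorem projTypeZero_apply_vec_two (A : FormFibre E 2 x) (a b : TangentSpace 𝓘(ℝ, E) x) :
    projTypeZero J x A ![a, b] = 1 / 4 * (A ![a, b] - Complex.I * A ![J x a, b] -
      Complex.I * A ![a, J x b] - A ![J x a, J x b]) := by
  have hite (S : Finset (Fin 2)) :
      (fun i => if i ∈ S then J x (![a, b] i) else ![a, b] i) =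
        ![if 0 ∈ S then J x a else a, if 1 ∈ S then J x b else b] := by
    funext i
    fin_cases i <;> rfl
  have huniv : (Finset.univ : Finset (Finset (Fin 2))) = {∅, {0}, {1}, {0, 1}} := by decide
  simp only [projTypeZero_apply, hite]
  rw [huniv, Finset.sum_insert (by decide), Finset.sum_insert (by decide),
    Finset.sum_insert (by decide), Finset.sum_singleton]
  simp
  ring

theorem projTypeZero_add (A B : FormFibre E k x) :
    projTypeZero J x (A + B) = projTypeZero J x A + projTypeZero J x B := by
  ext w
  simp only [projTypeZero_apply, ContinuousAlternatingMap.add_apply, mul_add,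
    Finset.sum_add_distrib]

theorem projTypeZero_smul (c : ℂ) (A : FormFibre E k x) :
    projTypeZero J x (c • A) = c • projTypeZero J x A := by
  ext w
  simp only [projTypeZero_apply, ContinuousAlternatingMap.smul_apply, smul_eq_mul,
    Finset.mul_sum, mul_left_comm]

theorem IsTypeZero.apply_ite (hA : IsTypeZero J x A) (w : Fin k → TangentSpace 𝓘(ℝ, E) x)
    (S : Finset (Fin k)) :
    A (fun i => if i ∈ S then J x (w i) else w i) = Complex.I ^ S.card * A w := by
  induction S using Finset.induction_on with
  | empty => simp
  | insert a S ha ih =>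
    have hupdate : (fun i => if i ∈ insert a S then J x (w i) else w i) =
        Function.update (fun i => if i ∈ S then J x (w i) else w i) a
          (J x (if a ∈ S then J x (w a) else w a)) := by
      funext i
      rcases eq_or_ne i a with rfl | hi
      · simp [ha]
      · simp [hi]
    rw [hupdate, hA _ a, ih, Finset.card_insert_of_notMem ha, pow_succ']
    ring

theorem IsTypeZero.projTypeZero_eq (hA : IsTypeZero J x A) : projTypeZero J x A = A := by
  ext w
  have hterm (S : Finset (Fin k)) : (1 / 2 : ℂ) ^ k * (-Complex.I) ^ S.card *
      A (fun i => if i ∈ S then J x (w i) else w i) = (1 / 2 : ℂ) ^ k * A w := by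
    rw [hA.apply_ite, mul_assoc, ← mul_assoc (_ ^ S.card), ← mul_pow, neg_mul, Complex.I_mul_I,
      neg_neg, one_pow, one_mul]
  rw [projTypeZero_apply, Finset.sum_congr rfl fun S _ => hterm S, Finset.sum_const,
    Finset.card_univ, Fintype.card_finset, Fintype.card_fin, nsmul_eq_mul, ← mul_assoc,
    Nat.cast_pow, ← mul_pow]
  norm_num

theorem isTypeZero_projTypeZero (hJ : ∀ v, J x (J x v) = -v) (A : FormFibre E k x) :
    IsTypeZero J x (projTypeZero J x A) := by
  intro w i
  have hsplit (f : Finset (Fin k) → ℂ) :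
      ∑ S, f S = ∑ S ∈ (Finset.univ.erase i).powerset, (f S + f (insert i S)) := by
    rw [Finset.sum_add_distrib, ← Finset.sum_powerset_insert (Finset.notMem_erase i _),
      Finset.insert_erase (Finset.mem_univ i), Finset.powerset_univ]
  rw [projTypeZero_apply, projTypeZero_apply, Finset.mul_sum, hsplit, hsplit]
  refine Finset.sum_congr rfl fun S hS => ?_
  have hi : i ∉ S := fun h => by simpa using Finset.mem_powerset.1 hS h
  let wS : Fin k → TangentSpace 𝓘(ℝ, E) x := fun j => if j ∈ S then J x (w j) else w j
  have h_not : (fun j => if j ∈ S then J x (Function.update w i (J x (w i)) j)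
      else Function.update w i (J x (w i)) j) = Function.update wS i (J x (w i)) := by
    funext j
    rcases eq_or_ne j i with rfl | hj <;> simp [wS, *]
  have h_mem : (fun j => if j ∈ insert i S then J x (Function.update w i (J x (w i)) j)
      else Function.update w i (J x (w i)) j) = Function.update wS i (-w i) := by
    funext j
    rcases eq_or_ne j i with rfl | hj <;> simp [wS, *]
  have h_insert : (fun j => if j ∈ insert i S then J x (w j) else w j) =
      Function.update wS i (J x (w i)) := by
    funext j
    rcases eq_or_ne j i with rfl | hj <;> simp [wS, *]
  have h_neg : A (Function.update wS i (-w i)) = -A wS := by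
    have hwS : Function.update wS i (w i) = wS := by simp [wS, hi]
    rw [← hwS, Function.update_idem]
    exact A.toAlternatingMap.map_update_neg wS i (w i)
  rw [h_not, h_mem, h_insert, h_neg, Finset.card_insert_of_notMem hi, pow_succ]
  linear_combination (1 / 2 : ℂ) ^ k * (-Complex.I) ^ S.card *
    A (Function.update wS i (J x (w i))) * Complex.I_sq

theorem isTypeZero_dbarForm (hJ : ∀ v, J x (J x v) = -v) (ψ : ∀ x : M, FormFibre E n x)
    (v : TangentSpace 𝓘(ℝ, E) x) : IsTypeZero J x (dbarForm J ψ x v) :=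
  isTypeZero_projTypeZero hJ _

end TypeZero

section Leibniz

variable {f g : M → ℂ} {ψ : ∀ x : M, FormFibre E n x}

theorem dbarFun_mul (hf : MDifferentiableAt 𝓘(ℝ, E) 𝓘(ℝ, ℂ) f x)
    (hg : MDifferentiableAt 𝓘(ℝ, E) 𝓘(ℝ, ℂ) g x) (v : TangentSpace 𝓘(ℝ, E) x) :
    dbarFun J (f * g) x v = f x * dbarFun J g x v + g x * dbarFun J f x v := by
  have hd (u : TangentSpace 𝓘(ℝ, E) x) :
      diffFun (f * g) x u = f x * diffFun g x u + g x * diffFun f x u :=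
    DFunLike.congr_fun (hf.hasMFDerivAt.mul hg.hasMFDerivAt).mfderiv u
  simp only [dbarFun, hd]
  ring

theorem dbarFun_pow (hf : MDifferentiableAt 𝓘(ℝ, E) 𝓘(ℝ, ℂ) f x) (m : ℕ)
    (v : TangentSpace 𝓘(ℝ, E) x) :
    dbarFun J (f ^ m) x v = m * f x ^ (m - 1) * dbarFun J f x v := by
  induction m with
  | zero =>
    have hd (u : TangentSpace 𝓘(ℝ, E) x) : diffFun (1 : M → ℂ) x u = 0 :=
      DFunLike.congr_fun (mfderiv_const (c := (1 : ℂ))) u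
    simp [dbarFun, hd]
  | succ m ih =>
    rw [pow_succ, dbarFun_mul (hf.pow m) hf, ih]
    rcases m with _ | m <;> simp
    ring

theorem extDeriv_smul_apply {𝕜 𝕜' F : Type*} [NontriviallyNormedField 𝕜] [NormedField 𝕜']
    [NormedAlgebra 𝕜 𝕜'] [NormedAddCommGroup F] [NormedSpace 𝕜 F] [NormedSpace 𝕜' F]
    [IsScalarTower 𝕜 𝕜' F] {E : Type*} [NormedAddCommGroup E] [NormedSpace 𝕜 E]
    {f : E → 𝕜'} {η : E → E [⋀^Fin n]→L[𝕜] F} {y : E}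
    (hf : DifferentiableAt 𝕜 f y) (hη : DifferentiableAt 𝕜 η y) (w : Fin (n + 1) → E) :
    extDeriv (fun z => f z • η z) y w =
      f y • extDeriv η y w + ∑ i, (-1) ^ i.val • (fderiv 𝕜 f y (w i) • η y (i.removeNth w)) := by
  rw [extDeriv, fderiv_fun_smul hf hη,
    ContinuousAlternatingMap.alternatizeUncurryFin_add,
    ContinuousAlternatingMap.alternatizeUncurryFin_smul, ContinuousAlternatingMap.add_apply,
    ContinuousAlternatingMap.alternatizeUncurryFin_apply]
  rfl

theorem formInChart_extChartAt_self [IsManifold 𝓘(ℝ, E) 1 M] (ψ : ∀ x : M, FormFibre E n x)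
    (x : M) : formInChart ψ x (extChartAt 𝓘(ℝ, E) x x) = ψ x := by
  have h := mfderivWithin_range_extChartAt_symm (I := 𝓘(ℝ, E)) (x := x)
  rw [ModelWithCorners.range_eq_univ, mfderivWithin_univ] at h
  rw [formInChart, h, extChartAt_to_inv]
  rfl

theorem extDerivAt_eq [IsManifold 𝓘(ℝ, E) 1 M] (ψ : ∀ x : M, FormFibre E n x) (x : M) :
    extDerivAt ψ x = extDeriv (formInChart ψ x) (extChartAt 𝓘(ℝ, E) x x) := by
  rw [extDerivAt, mfderiv_extChartAt_self]
  rfl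

theorem diffFun_eq_fderiv (hf : MDifferentiableAt 𝓘(ℝ, E) 𝓘(ℝ, ℂ) f x) :
    diffFun f x = fderiv ℝ (f ∘ (extChartAt 𝓘(ℝ, E) x).symm) (extChartAt 𝓘(ℝ, E) x x) := by
  rw [diffFun, hf.mfderiv, ModelWithCorners.range_eq_univ, fderivWithin_univ]
  rfl

theorem differentiableAt_comp_extChartAt_symm (hf : MDifferentiableAt 𝓘(ℝ, E) 𝓘(ℝ, ℂ) f x) :
    DifferentiableAt ℝ (f ∘ (extChartAt 𝓘(ℝ, E) x).symm) (extChartAt 𝓘(ℝ, E) x x) := by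
  have h := hf.differentiableWithinAt_writtenInExtChartAt
  rwa [ModelWithCorners.range_eq_univ, differentiableWithinAt_univ] at h

theorem extDerivAt_smul_apply [IsManifold 𝓘(ℝ, E) 1 M]
    (hf : MDifferentiableAt 𝓘(ℝ, E) 𝓘(ℝ, ℂ) f x)
    (hψ : DifferentiableAt ℝ (formInChart ψ x) (extChartAt 𝓘(ℝ, E) x x))
    (w : Fin (n + 1) → TangentSpace 𝓘(ℝ, E) x) :
    extDerivAt (fun z => f z • ψ z) x w =
      f x * extDerivAt ψ x w + ∑ i, (-1) ^ i.val • (diffFun f x (w i) * ψ x (i.removeNth w)) := by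
  have h := extDeriv_smul_apply (differentiableAt_comp_extChartAt_symm hf) hψ w
  rw [← diffFun_eq_fderiv hf, Function.comp, extChartAt_to_inv, formInChart_extChartAt_self,
    ← extDerivAt_eq ψ] at h
  rw [extDerivAt_eq (fun z => f z • ψ z)]
  exact h

theorem IsTypeZero.removeNth_succ_vecCons {A : FormFibre E n x} (hA : IsTypeZero J x A)
    (v : TangentSpace 𝓘(ℝ, E) x) (w : Fin n → TangentSpace 𝓘(ℝ, E) x) (i : Fin n) :
    A (i.succ.removeNth (Matrix.vecCons (J x v) w : Fin (n + 1) → TangentSpace 𝓘(ℝ, E) x)) =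
      Complex.I *
        A (i.succ.removeNth (Matrix.vecCons v w : Fin (n + 1) → TangentSpace 𝓘(ℝ, E) x)) := by
  rcases n with _ | n
  · exact i.elim0
  · rw [← hA _ 0]
    congr 1
    funext j
    induction j using Fin.cases with
    | zero => rfl
    | succ j => simp [Fin.removeNth]

/-- The Leibniz rule. In `d(f ψ) = df ∧ ψ + f dψ` the terms of `(df ∧ ψ)(v^{0,1}, ·)` where
`v^{0,1}` is fed to `ψ` vanish, since `ψ` is complex linear. -/
theorem dbarForm_smul [IsManifold 𝓘(ℝ, E) 1 M] (hf : MDifferentiableAt 𝓘(ℝ, E) 𝓘(ℝ, ℂ) f x)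
    (hψ : DifferentiableAt ℝ (formInChart ψ x) (extChartAt 𝓘(ℝ, E) x x))
    (hx : IsTypeZero J x (ψ x)) (v : TangentSpace 𝓘(ℝ, E) x) :
    dbarForm J (fun y => f y • ψ y) x v = dbarFun J f x v • ψ x + f x • dbarForm J ψ x v := by
  let contract (η : FormFibre E (n + 1) x) : FormFibre E n x :=
    (1 / 2 : ℂ) • (ContinuousAlternatingMap.curryLeft (E := E) η v +
      Complex.I • ContinuousAlternatingMap.curryLeft (E := E) η (J x v))
  have hcontract : contract (extDerivAt (fun y => f y • ψ y) x) =
      dbarFun J f x v • ψ x + f x • contract (extDerivAt ψ x) := by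
    ext w
    have hd (u : TangentSpace 𝓘(ℝ, E) x) := (extDerivAt_smul_apply hf hψ
      (Matrix.vecCons u w : Fin (n + 1) → TangentSpace 𝓘(ℝ, E) x))
    change (1 / 2 : ℂ) * (extDerivAt (fun y => f y • ψ y) x (Matrix.vecCons v w) +
        Complex.I * extDerivAt (fun y => f y • ψ y) x (Matrix.vecCons (J x v) w)) =
      dbarFun J f x v * ψ x w + f x * ((1 / 2 : ℂ) * (extDerivAt ψ x (Matrix.vecCons v w) +
        Complex.I * extDerivAt ψ x (Matrix.vecCons (J x v) w)))
    rw [hd, hd, Fin.sum_univ_succ, Fin.sum_univ_succ]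
    have hsum : ∑ i : Fin n, (-1) ^ i.succ.val • (diffFun f x (w i) * ψ x (i.succ.removeNth
          (Matrix.vecCons (J x v) w : Fin (n + 1) → TangentSpace 𝓘(ℝ, E) x))) =
        Complex.I * ∑ i : Fin n, (-1) ^ i.succ.val • (diffFun f x (w i) * ψ x (i.succ.removeNth
          (Matrix.vecCons v w : Fin (n + 1) → TangentSpace 𝓘(ℝ, E) x))) := by
      rw [Finset.mul_sum]
      refine Finset.sum_congr rfl fun i _ => ?_
      rw [hx.removeNth_succ_vecCons, mul_smul_comm, mul_left_comm]
    have hzero (u : TangentSpace 𝓘(ℝ, E) x) : (0 : Fin (n + 1)).removeNth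
        (Matrix.vecCons u w : Fin (n + 1) → TangentSpace 𝓘(ℝ, E) x) = w := rfl
    simp only [Matrix.cons_val_succ, Matrix.cons_val_zero, hzero, hsum, dbarFun, Fin.val_zero,
      pow_zero, one_smul]
    linear_combination (1 / 2 : ℂ) * (∑ i : Fin n, (-1) ^ i.succ.val •
      (diffFun f x (w i) * ψ x (i.succ.removeNth
        (Matrix.vecCons v w : Fin (n + 1) → TangentSpace 𝓘(ℝ, E) x)))) * Complex.I_sq
  change projTypeZero J x (contract _) = _ • _ + _ • projTypeZero J x (contract _)
  rw [hcontract, projTypeZero_add, projTypeZero_smul, projTypeZero_smul, hx.projTypeZero_eq]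

end Leibniz

section FormPow

variable {f : M → ℂ} {ψ χ : ∀ x : M, FormFibre E n x}

theorem formPow_smul (f : M → ℂ) (ψ : ∀ x : M, FormFibre E n x) (m : ℕ) (x : M) :
    formPow m (fun y => f y • ψ y) x = f x ^ m • formPow m ψ x := by
  simpa only [formPow, Finset.prod_const, Finset.card_univ, Fintype.card_fin] using
    MultilinearMap.map_smul_univ (PiTensorProduct.tprod ℂ) (fun _ : Fin m => f x) fun _ => ψ x

theorem formPow_ne_zero (hx : ψ x ≠ 0) (m : ℕ) : formPow m ψ x ≠ 0 := by
  obtain ⟨w, hw⟩ : ∃ w, ψ x w ≠ 0 := by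
    by_contra! hzero
    exact hx (ContinuousAlternatingMap.ext hzero)
  let eval : FormFibre E n x →ₗ[ℂ] ℂ :=
    { toFun := fun A => A w, map_add' := fun _ _ => rfl, map_smul' := fun _ _ => rfl }
  intro hzero
  have hlift := congrArg (PiTensorProduct.lift
    ((MultilinearMap.mkPiAlgebra ℂ (Fin m) ℂ).compLinearMap fun _ => eval)) hzero
  rw [formPow, PiTensorProduct.lift.tprod, map_zero] at hlift
  have hpow : ψ x w ^ m = 0 := by simpa [eval] using hlift
  exact pow_ne_zero m hw hpow

theorem sum_tprod_update_smul_add {V : Type*} [AddCommGroup V] [Module ℂ V] (a b : ℂ) (A B : V)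
    (m : ℕ) :
    ∑ i : Fin m, PiTensorProduct.tprod ℂ (Function.update (fun _ => A) i (a • A + b • B)) =
      (m * a) • PiTensorProduct.tprod ℂ (fun _ : Fin m => A) +
        b • ∑ i : Fin m, PiTensorProduct.tprod ℂ (Function.update (fun _ => A) i B) := by
  simp only [MultilinearMap.map_update_add, MultilinearMap.map_update_smul,
    Function.update_eq_self, Finset.sum_add_distrib, ← Finset.smul_sum, Finset.sum_const,
    Finset.card_univ, Fintype.card_fin, mul_smul, Nat.cast_smul_eq_nsmul, smul_comm m a]

theorem dbarFormPow_of_dbarForm_eq_smul {v : TangentSpace 𝓘(ℝ, E) x} {c : ℂ}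
    (hc : dbarForm J ψ x v = c • ψ x) (m : ℕ) :
    dbarFormPow J m ψ x v = (m * c) • formPow m ψ x := by
  rw [dbarFormPow, formPow, hc]
  simpa only [smul_zero, zero_smul, add_zero] using sum_tprod_update_smul_add c 0 (ψ x) 0 m

theorem dbarForm_congr (hχ : ∀ᶠ y in 𝓝 x, χ y = ψ y) (v : TangentSpace 𝓘(ℝ, E) x) :
    dbarForm J χ x v = dbarForm J ψ x v := by
  have hchart : formInChart χ x =ᶠ[𝓝 (extChartAt 𝓘(ℝ, E) x x)] formInChart ψ x := by
    have hsymm := (continuousAt_extChartAt_symm (I := 𝓘(ℝ, E)) x).eventually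
      (p := fun y => χ y = ψ y) (by rwa [extChartAt_to_inv])
    filter_upwards [hsymm] with y hy
    rw [formInChart, hy, formInChart]
  rw [dbarForm, dbarForm, extDerivAt, extDerivAt, hchart.extDeriv_eq]

theorem dbarFormPow_congr (hχ : ∀ᶠ y in 𝓝 x, χ y = ψ y) (m : ℕ) (v : TangentSpace 𝓘(ℝ, E) x) :
    dbarFormPow J m χ x v = dbarFormPow J m ψ x v := by
  rw [dbarFormPow, dbarFormPow, dbarForm_congr hχ, hχ.self_of_nhds]

theorem dbarFormPow_smul [IsManifold 𝓘(ℝ, E) 1 M] (hf : MDifferentiableAt 𝓘(ℝ, E) 𝓘(ℝ, ℂ) f x)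
    (hψ : DifferentiableAt ℝ (formInChart ψ x) (extChartAt 𝓘(ℝ, E) x x))
    (hx : IsTypeZero J x (ψ x)) (m : ℕ) (v : TangentSpace 𝓘(ℝ, E) x) :
    dbarFormPow J m (fun y => f y • ψ y) x v =
      (m * f x ^ (m - 1) * dbarFun J f x v) • formPow m ψ x + f x ^ m • dbarFormPow J m ψ x v := by
  rcases m with _ | m
  · simp [dbarFormPow]
  have hupdate (i : Fin (m + 1)) (B : FormFibre E n x) :
      PiTensorProduct.tprod ℂ (Function.update (fun _ => f x • ψ x) i B) =
        f x ^ m • PiTensorProduct.tprod ℂ (Function.update (fun _ => ψ x) i B) := by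
    have hsmul := MultilinearMap.map_smul_univ (PiTensorProduct.tprod ℂ)
      (Function.update (fun _ : Fin (m + 1) => f x) i 1) (Function.update (fun _ => ψ x) i B)
    rw [Finset.prod_update_of_mem (Finset.mem_univ i), one_mul, Finset.prod_const,
      Finset.card_sdiff_of_subset (Finset.subset_univ _), Finset.card_univ, Fintype.card_fin,
      Finset.card_singleton, Nat.add_sub_cancel] at hsmul
    rw [← hsmul]
    congr 1
    funext j
    rcases eq_or_ne j i with rfl | hj <;> simp [*]
  simp only [dbarFormPow, hupdate, ← Finset.smul_sum, dbarForm_smul hf hψ hx]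
  rw [sum_tprod_update_smul_add, smul_add, smul_smul, smul_smul, ← pow_succ, formPow,
    Nat.add_sub_cancel]
  congr 2
  ring

end FormPow

section Frame

variable {h : M → ℂ} {ψ χ : ∀ x : M, FormFibre E n x}

theorem IsSmoothFormOn.contDiffAt (hψ : IsSmoothFormOn ψ U) (hU : U ∈ 𝓝 x) :
    ContDiffAt ℝ ∞ (formInChart ψ x) (extChartAt 𝓘(ℝ, E) x x) := by
  refine (hψ x).contDiffAt (Filter.inter_mem (extChartAt_target_mem_nhds x) ?_)
  exact continuousAt_extChartAt_symm (I := 𝓘(ℝ, E)) x (by rwa [extChartAt_to_inv])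

theorem contMDiffOn_of_eq_smul [IsManifold 𝓘(ℝ, E) 1 M] (hU : IsOpen U)
    (hχ : IsSmoothFormOn χ U) (hψ : IsSmoothFormOn ψ U) (hψ₀ : ∀ x ∈ U, ψ x ≠ 0)
    (hh : ∀ x ∈ U, χ x = h x • ψ x) : ContMDiffOn 𝓘(ℝ, E) 𝓘(ℝ, ℂ) ∞ h U := by
  intro x hx
  have hUx : U ∈ 𝓝 x := hU.mem_nhds hx
  refine (contMDiffAt_iff_source.2 ?_).contMDiffWithinAt
  obtain ⟨w, hw⟩ : ∃ w, ψ x w ≠ 0 := by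
    by_contra! hzero
    exact hψ₀ x hx (ContinuousAlternatingMap.ext hzero)
  have heval {η : ∀ x : M, FormFibre E n x} (hη : IsSmoothFormOn η U) :
      ContDiffAt ℝ ∞ (fun y : E => formInChart η x y w) (extChartAt 𝓘(ℝ, E) x x) :=
    (ContinuousAlternatingMap.apply ℝ E ℂ w).contDiff.contDiffAt.comp _ (hη.contDiffAt hUx)
  have hne : formInChart ψ x (extChartAt 𝓘(ℝ, E) x x) w ≠ 0 := by
    rwa [formInChart_extChartAt_self]
  have hquot : h ∘ (extChartAt 𝓘(ℝ, E) x).symm =ᶠ[𝓝 (extChartAt 𝓘(ℝ, E) x x)]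
      fun y : E => formInChart χ x y w * (formInChart ψ x y w)⁻¹ := by
    have hsymm := (continuousAt_extChartAt_symm (I := 𝓘(ℝ, E)) x).eventually
      (p := fun y => y ∈ U) (by rwa [extChartAt_to_inv])
    filter_upwards [hsymm, (heval hψ).continuousAt.eventually_ne hne] with y hyU hy
    rw [eq_mul_inv_iff_mul_eq₀ hy]
    exact (congrArg (fun A : FormFibre E n _ => A.compContinuousLinearMap (mfderiv 𝓘(ℝ, E) 𝓘(ℝ, E)
      (extChartAt 𝓘(ℝ, E) x).symm y) w) (hh _ hyU)).symm
  exact (((heval hχ).mul ((heval hψ).inv hne)).congr_of_eventuallyEq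
    hquot).contMDiffAt.contMDiffWithinAt

/-- If the forms of type `(n, 0)` at each point span a line, one global frame suffices to detect
pseudoholomorphic sections: another local frame `ψ` is related to it by `χ = h ψ`, and both
`∂̄(f χ^m)` and `∂̄((f h^m) ψ^m)` expand by the Leibniz rule to the same section. -/
theorem mem_pluricanonicalSections_iff [IsManifold 𝓘(ℝ, E) 1 M]
    (hline : ∀ (x : M) (A B : FormFibre E n x), IsTypeZero J x A → IsTypeZero J x B → B ≠ 0 →
      ∃ c : ℂ, A = c • B)
    (hχ : IsCanonicalFrameOn J χ univ) {σ : ∀ x : M, TensorFibre E n m x} :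
    σ ∈ pluricanonicalSections J n m ↔ IsPseudoholomorphicInFrame J χ univ σ := by
  refine ⟨fun hσ => hσ univ χ isOpen_univ hχ, ?_⟩
  rintro ⟨f, hf, hfσ⟩ U ψ hU hψ
  have hsmul (x : M) : ∃ c : ℂ, x ∈ U → χ x = c • ψ x := by
    by_cases hx : x ∈ U
    · obtain ⟨c, hc⟩ := hline x _ _ (hχ.type_zero x trivial) (hψ.type_zero x hx) (hψ.ne_zero x hx)
      exact ⟨c, fun _ => hc⟩
    · exact ⟨0, fun hx' => absurd hx' hx⟩
  choose h hh using hsmul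
  have hh_smooth : ContMDiffOn 𝓘(ℝ, E) 𝓘(ℝ, ℂ) ∞ h U :=
    contMDiffOn_of_eq_smul hU (fun x₀ => (hχ.smooth x₀).mono
      (inter_subset_inter_right _ (preimage_mono (subset_univ U)))) hψ.smooth hψ.ne_zero hh
  have hfh_smooth : ContMDiffOn 𝓘(ℝ, E) 𝓘(ℝ, ℂ) ∞ (f * h ^ m) U :=
    (contDiff_fst.mul (contDiff_snd.pow m)).contMDiff.comp_contMDiffOn
      ((hf.mono (subset_univ U)).prodMk_space hh_smooth)
  refine ⟨f * h ^ m, hfh_smooth, fun x hx => ?_⟩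
  have hUx : U ∈ 𝓝 x := hU.mem_nhds hx
  have hχψ : ∀ᶠ y in 𝓝 x, χ y = h y • ψ y := Filter.eventually_of_mem hUx hh
  have hf_diff : MDifferentiableAt 𝓘(ℝ, E) 𝓘(ℝ, ℂ) f x :=
    (hf.contMDiffAt Filter.univ_mem).mdifferentiableAt (by simp)
  have hh_diff : MDifferentiableAt 𝓘(ℝ, E) 𝓘(ℝ, ℂ) h x :=
    (hh_smooth.contMDiffAt hUx).mdifferentiableAt (by simp)
  have hψ_diff : DifferentiableAt ℝ (formInChart ψ x) (extChartAt 𝓘(ℝ, E) x x) :=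
    (hψ.smooth.contDiffAt hUx).differentiableAt (by simp)
  have hpow : formPow m χ x = h x ^ m • formPow m ψ x := by
    rw [← formPow_smul, formPow, formPow, hh x hx]
  obtain ⟨hσ, hdbar⟩ := hfσ x trivial
  refine ⟨by rw [hσ, hpow, smul_smul]; rfl, fun v => ?_⟩
  rw [← hdbar v, dbarFormPow_congr hχψ, dbarFormPow_smul hh_diff hψ_diff (hψ.type_zero x hx), hpow,
    dbarFun_mul hf_diff (hh_diff.pow m), dbarFun_pow hh_diff]
  simp only [Pi.mul_apply, Pi.pow_apply, smul_add, smul_smul, add_smul]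
  module

theorem isPseudoholomorphicInFrame_iff_of_dbarForm_eq_smul
    {α : ∀ x : M, TangentSpace 𝓘(ℝ, E) x → ℂ} (hψ : ∀ x ∈ U, ψ x ≠ 0)
    (hα : ∀ x ∈ U, ∀ v, dbarForm J ψ x v = α x v • ψ x) {σ : ∀ x : M, TensorFibre E n m x} :
    IsPseudoholomorphicInFrame J ψ U σ ↔
      ∃ f : M → ℂ, ContMDiffOn 𝓘(ℝ, E) 𝓘(ℝ, ℂ) ∞ f U ∧ ∀ x ∈ U,
        σ x = f x • formPow m ψ x ∧ ∀ v, dbarFun J f x v + m * α x v * f x = 0 := by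
  refine exists_congr fun f => and_congr_right fun _ => forall₂_congr fun x hx =>
    and_congr_right fun _ => forall_congr' fun v => ?_
  rw [dbarFormPow_of_dbarForm_eq_smul (hα x hx v), smul_smul, ← add_smul, smul_eq_zero,
    or_iff_left (formPow_ne_zero (hψ x hx) m), mul_comm (f x)]

end Frame

section KodairaDimension

theorem kodairaDim_eq_bot (h : ∀ m, 1 ≤ m → plurigenus J n m = 0) : kodairaDim J n = ⊥ :=
  if_pos h

theorem kodairaDim_eq_zero (hle : ∀ m, plurigenus J n m ≤ 1)
    (hone : ∃ᶠ m in Filter.atTop, plurigenus J n m = 1) : kodairaDim J n = 0 := by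
  rw [kodairaDim, if_neg]
  · refine le_antisymm (Filter.limsup_le_of_le (by isBoundedDefault) ?_)
      (Filter.le_limsup_of_frequently_le (hone.mono fun m hm => ?_) (by isBoundedDefault))
    · filter_upwards [Filter.eventually_ge_atTop 2] with m hm
      have hlog : 0 < Real.log m := Real.log_pos (by exact_mod_cast hm)
      rcases Nat.le_one_iff_eq_zero_or_eq_one.1 (hle m) with hzero | hone
      · rw [hzero, Nat.cast_zero, ENNReal.log_zero,
          EReal.bot_div_of_pos_ne_top (EReal.coe_pos.2 hlog) (EReal.coe_ne_top _)]
        exact bot_le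
      · rw [hone, Nat.cast_one, ENNReal.log_one, EReal.zero_div]
    · rw [hm, Nat.cast_one, ENNReal.log_one, EReal.zero_div]
  · intro hzero
    obtain ⟨m, hm, hpos⟩ := Filter.frequently_atTop.1 hone 1
    exact one_ne_zero (hpos.symm.trans (hzero m hm))

end KodairaDimension

end AlmostComplex

namespace KodairaThurston

open AlmostComplex

section Topology

theorem isOpenQuotientMap_proj : IsOpenQuotientMap proj :=
  ⟨proj_surjective, continuous_proj, isOpenMap_proj⟩

theorem proj_coordMul (k : Fin 4 → ℤ) (p : Fin 4 → ℝ) :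
    proj (coordMul (fun i => (k i : ℝ)) p) = proj p :=
  (proj_eq_iff _ _).2 ⟨k, rfl⟩

theorem proj_eq_iff_mem_range_intCast (p q : Fin 4 → ℝ) :
    proj p = proj q ↔ p 0 - q 0 ∈ range ((↑) : ℤ → ℝ) ∧ p 1 - q 1 ∈ range ((↑) : ℤ → ℝ) ∧
      p 2 - q 2 - (p 0 - q 0) * q 1 ∈ range ((↑) : ℤ → ℝ) ∧
      p 3 - q 3 ∈ range ((↑) : ℤ → ℝ) := by
  rw [proj_eq_iff]
  constructor
  · rintro ⟨k, rfl⟩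
    exact ⟨⟨k 0, by simp [coordMul]⟩, ⟨k 1, by simp [coordMul]⟩,
      ⟨k 2, by simp [coordMul]; ring⟩, ⟨k 3, by simp [coordMul]⟩⟩
  · rintro ⟨⟨a, ha⟩, ⟨b, hb⟩, ⟨c, hc⟩, ⟨d, hd⟩⟩
    refine ⟨![a, b, c, d], ?_⟩
    rw [← ha] at hc
    funext i
    fin_cases i <;> simp [coordMul] <;> linarith

instance : T2Space KT := by
  rw [t2Space_iff_of_isOpenQuotientMap isOpenQuotientMap_proj]
  simp only [proj_eq_iff_mem_range_intCast, ofPred_and]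
  have hclosed := Real.isClosed_range_intCast
  exact (hclosed.preimage (by fun_prop)).inter ((hclosed.preimage (by fun_prop)).inter
    ((hclosed.preimage (by fun_prop)).inter (hclosed.preimage (by fun_prop))))

theorem proj_image_Icc : proj '' Icc 0 1 = univ := by
  refine eq_univ_of_forall fun m => ?_
  obtain ⟨p, rfl⟩ := proj_surjective m
  refine ⟨![Int.fract (p 0), Int.fract (p 1), Int.fract (p 2 - ⌊p 0⌋ * Int.fract (p 1)),
    Int.fract (p 3)], ⟨fun i => ?_, fun i => ?_⟩, Eq.symm ?_⟩
  · fin_cases i <;> simp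
  · fin_cases i <;> simp [(Int.fract_lt_one _).le]
  · rw [proj_eq_iff_mem_range_intCast]
    refine ⟨⟨⌊p 0⌋, by simp⟩, ⟨⌊p 1⌋, by simp⟩, ⟨⌊p 2 - ⌊p 0⌋ * Int.fract (p 1)⌋, ?_⟩,
      ⟨⌊p 3⌋, by simp⟩⟩
    simp only [Matrix.cons_val, Int.self_sub_fract]
    linarith [Int.self_sub_fract (p 2 - ⌊p 0⌋ * Int.fract (p 1))]

instance : CompactSpace KT :=
  ⟨proj_image_Icc ▸ isCompact_Icc.image continuous_proj⟩

end Topology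

section Charts

theorem chart_proj {c p : Fin 4 → ℝ} (hp : p ∈ Metric.ball c (1 / 2)) : chart c (proj p) = p :=
  (chart c).right_inv hp

theorem extChartAt_eq (m : KT) : ⇑(extChartAt 𝓘(ℝ, Fin 4 → ℝ) m) = chart (lift m) := rfl

theorem extChartAt_self (m : KT) : extChartAt 𝓘(ℝ, Fin 4 → ℝ) m m = lift m := by
  have h := chart_proj (Metric.mem_ball_self (x := lift m) (ε := 1 / 2) (by norm_num))
  rwa [proj_lift, ← extChartAt_eq] at h

theorem proj_mem_chartAt_source {m : KT} {y : Fin 4 → ℝ}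
    (hy : y ∈ Metric.ball (lift m) (1 / 2)) : proj y ∈ (chartAt (Fin 4 → ℝ) m).source :=
  ⟨y, hy, rfl⟩

theorem contMDiff_proj : ContMDiff 𝓘(ℝ, Fin 4 → ℝ) 𝓘(ℝ, Fin 4 → ℝ) ∞ proj := by
  intro p
  have hchart : chart p ∈ IsManifold.maximalAtlas 𝓘(ℝ, Fin 4 → ℝ) ∞ KT :=
    IsManifold.subset_maximalAtlas ⟨p, rfl⟩
  exact (contMDiffOn_symm_of_mem_maximalAtlas hchart).contMDiffAt
    ((chart p).open_target.mem_nhds (Metric.mem_ball_self (by norm_num)))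

theorem contMDiffAt_of_comp_proj {f : KT → ℂ} {m : KT}
    (hf : ContDiffAt ℝ ∞ (f ∘ proj) (lift m)) :
    ContMDiffAt 𝓘(ℝ, Fin 4 → ℝ) 𝓘(ℝ, ℂ) ∞ f m := by
  rw [← extChartAt_self] at hf
  refine (hf.comp_contMDiffAt contMDiffAt_extChartAt).congr_of_eventuallyEq ?_
  filter_upwards [(chart (lift m)).open_source.mem_nhds (mem_chart_source _ m)] with q hq
  rw [Function.comp_apply, Function.comp_apply, extChartAt_eq, proj_chart _ hq]

end Charts

section Differential

/-- The differential of the covering `proj`, as an endomorphism of the model space `ℝ⁴`. -/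
noncomputable def dproj (p : Fin 4 → ℝ) : (Fin 4 → ℝ) →L[ℝ] (Fin 4 → ℝ) :=
  mfderiv 𝓘(ℝ, Fin 4 → ℝ) 𝓘(ℝ, Fin 4 → ℝ) proj p

theorem hasMFDerivAt_proj (p : Fin 4 → ℝ) :
    HasMFDerivAt 𝓘(ℝ, Fin 4 → ℝ) 𝓘(ℝ, Fin 4 → ℝ) proj p (dproj p) :=
  (contMDiff_proj.mdifferentiable (by simp) p).hasMFDerivAt

theorem mfderiv_extChartAt_dproj {m : KT} {y : Fin 4 → ℝ}
    (hy : y ∈ Metric.ball (lift m) (1 / 2)) (v : Fin 4 → ℝ) :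
    mfderiv 𝓘(ℝ, Fin 4 → ℝ) 𝓘(ℝ, Fin 4 → ℝ) (extChartAt 𝓘(ℝ, Fin 4 → ℝ) m) (proj y)
      (dproj y v) = v := by
  have hcomp := mfderiv_comp y
    (mdifferentiableAt_extChartAt (I := 𝓘(ℝ, Fin 4 → ℝ)) (proj_mem_chartAt_source hy))
    (hasMFDerivAt_proj y).mdifferentiableAt
  have hid : extChartAt 𝓘(ℝ, Fin 4 → ℝ) m ∘ proj =ᶠ[𝓝 y] id := by
    filter_upwards [Metric.isOpen_ball.mem_nhds hy] with q hq
    rw [Function.comp_apply, extChartAt_eq, chart_proj hq, id]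
  rw [hid.mfderiv_eq, mfderiv_id] at hcomp
  exact (DFunLike.congr_fun hcomp v).symm

theorem dproj_lift (m : KT) (v : Fin 4 → ℝ) : dproj (lift m) v = v := by
  have h := mfderiv_extChartAt_dproj (m := m) (Metric.mem_ball_self (by norm_num)) v
  rw [proj_lift, mfderiv_extChartAt_self] at h
  exact h

/-- The differential of left multiplication by an element of `G` whose `x`-coordinate is `a`; it is
the same at all points. -/
noncomputable def shear (a : ℝ) : (Fin 4 → ℝ) →L[ℝ] (Fin 4 → ℝ) :=
  ContinuousLinearMap.pi ![ContinuousLinearMap.proj 0, ContinuousLinearMap.proj 1,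
    ContinuousLinearMap.proj 2 + a • ContinuousLinearMap.proj 1, ContinuousLinearMap.proj 3]

theorem shear_apply (a : ℝ) (v : Fin 4 → ℝ) :
    shear a v = ![v 0, v 1, v 2 + a * v 1, v 3] := by
  funext i
  fin_cases i <;> simp [shear]

theorem shear_shear_neg (a : ℝ) (v : Fin 4 → ℝ) : shear a (shear (-a) v) = v := by
  funext i
  fin_cases i <;> simp [shear_apply]

theorem shear_neg_shear (a : ℝ) (v : Fin 4 → ℝ) : shear (-a) (shear a v) = v := by
  simpa only [neg_neg] using shear_shear_neg (-a) v

theorem hasFDerivAt_coordMul (k p : Fin 4 → ℝ) : HasFDerivAt (coordMul k) (shear (k 0)) p := by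
  have haffine : coordMul k = fun q => k + shear (k 0) q := by
    funext q i
    fin_cases i <;> simp [coordMul, shear_apply]
    ring
  rw [haffine]
  exact (ContinuousLinearMap.hasFDerivAt _).const_add k

theorem field_coordMul (i : Fin 4) (k p : Fin 4 → ℝ) :
    field i (coordMul k p) = shear (k 0) (field i p) := by
  funext j
  fin_cases i <;> fin_cases j <;> simp [field, coordMul, shear_apply]
  ring

theorem dproj_coordMul_shear (k : Fin 4 → ℤ) (p v : Fin 4 → ℝ) :
    dproj (coordMul (fun i => (k i : ℝ)) p) (shear (k 0) v) = dproj p v := by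
  have hcomp : HasMFDerivAt 𝓘(ℝ, Fin 4 → ℝ) 𝓘(ℝ, Fin 4 → ℝ) proj p
      ((dproj (coordMul (fun i => (k i : ℝ)) p)).comp (shear (k 0))) :=
    ((hasMFDerivAt_proj _).comp p (hasFDerivAt_coordMul _ p).hasMFDerivAt).congr_of_eventuallyEq
      (Filter.Eventually.of_forall fun q => (proj_coordMul k q).symm)
  exact (DFunLike.congr_fun (hasMFDerivAt_unique (hasMFDerivAt_proj p) hcomp) v).symm

theorem exists_dproj_eq_shear_neg (p : Fin 4 → ℝ) : ∃ k : Fin 4 → ℤ,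
    p = coordMul (fun i => (k i : ℝ)) (lift (proj p)) ∧
      ∀ v, dproj p v = shear (-(k 0)) v := by
  obtain ⟨k, hk⟩ := (proj_eq_iff p (lift (proj p))).1 (proj_lift _).symm
  refine ⟨k, hk, fun v => ?_⟩
  have h := dproj_coordMul_shear k (lift (proj p)) (shear (-(k 0)) v)
  rwa [dproj_lift, ← hk, shear_shear_neg] at h

theorem dproj_surjective (p : Fin 4 → ℝ) : Function.Surjective (dproj p) := by
  obtain ⟨k, -, hk⟩ := exists_dproj_eq_shear_neg p
  exact fun v => ⟨shear (k 0) v, by rw [hk, shear_neg_shear]⟩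

theorem dproj_field (p : Fin 4 → ℝ) (i : Fin 4) :
    dproj p (field i p) = field i (lift (proj p)) := by
  obtain ⟨k, hp, hk⟩ := exists_dproj_eq_shear_neg p
  conv_lhs => rw [hk, hp, field_coordMul, shear_neg_shear]

theorem mfderiv_proj_field (p : Fin 4 → ℝ) (i : Fin 4) :
    mfderiv 𝓘(ℝ, Fin 4 → ℝ) 𝓘(ℝ, Fin 4 → ℝ) proj p (field i p) = frame i (proj p) :=
  dproj_field p i

theorem diffFun_dproj {f : KT → ℂ} {p : Fin 4 → ℝ}
    (hf : MDifferentiableAt 𝓘(ℝ, Fin 4 → ℝ) 𝓘(ℝ, ℂ) f (proj p)) (v : Fin 4 → ℝ) :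
    diffFun f (proj p) (dproj p v) = fderiv ℝ (f ∘ proj) p v := by
  have hcomp : HasFDerivAt (f ∘ proj)
      ((diffFun f (proj p) : (Fin 4 → ℝ) →L[ℝ] ℂ).comp (dproj p)) p :=
    (hf.hasMFDerivAt.comp p (hasMFDerivAt_proj p)).hasFDerivAt
  rw [hcomp.fderiv]
  rfl

end Differential

section CoordinateFormula

/-- The endomorphism `J` over `t`, on tangent vectors of `G` at the point with coordinates `p`. -/
noncomputable def coordJ (t : ℂ) (p v : Fin 4 → ℝ) : Fin 4 → ℝ :=
  let b := -(t.im / (t.re + Real.pi)) * v 1 -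
    (‖t + Real.pi‖ ^ 2 / (t.re + Real.pi)) * (v 2 - p 0 * v 1)
  ![v 3, b, 1 / (t.re + Real.pi) * v 1 + t.im / (t.re + Real.pi) * (v 2 - p 0 * v 1) + p 0 * b,
    -v 0]

theorem coordJ_apply_zero (t : ℂ) (p v : Fin 4 → ℝ) : coordJ t p v 0 = v 3 := rfl

theorem Δ_re_add_pi_pos (t : Δ) : 0 < (t : ℂ).re + Real.pi := by
  have h : ‖(t : ℂ)‖ < Real.pi := mem_ball_zero_iff.1 t.2
  linarith [(abs_le.1 (Complex.abs_re_le_norm (t : ℂ))).1]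

theorem norm_add_pi_sq (t : ℂ) :
    ‖t + Real.pi‖ ^ 2 = (t.re + Real.pi) ^ 2 + t.im ^ 2 := by
  rw [← Complex.normSq_eq_norm_sq, Complex.normSq_apply]
  simp only [Complex.add_re, Complex.add_im, Complex.ofReal_re, Complex.ofReal_im]
  ring

theorem coordJ_coordJ (t : Δ) (p v : Fin 4 → ℝ) : coordJ t p (coordJ t p v) = -v := by
  have h := (Δ_re_add_pi_pos t).ne'
  funext j
  fin_cases j <;> simp [coordJ, norm_add_pi_sq] <;> field_simp <;> ring

theorem coordJ_congr {t : ℂ} {p q v : Fin 4 → ℝ} (h : p 0 = q 0) :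
    coordJ t p v = coordJ t q v := by
  simp only [coordJ, h]

theorem coordJ_field_zero (t : ℂ) (p q : Fin 4 → ℝ) : coordJ t p (field 0 q) = field 1 q := by
  funext i
  fin_cases i <;> simp [coordJ, field]

theorem coordJ_shear {t : ℂ} {a : ℝ} {p q : Fin 4 → ℝ} (hq : q 0 = p 0 + a) (v : Fin 4 → ℝ) :
    coordJ t q (shear a v) = shear a (coordJ t p v) := by
  funext j
  fin_cases j <;> simp [coordJ, shear_apply, hq, -mul_eq_mul_left_iff] <;> ring

theorem dproj_coordJ (t : ℂ) (p v : Fin 4 → ℝ) :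
    dproj p (coordJ t p v) = coordJ t (lift (proj p)) (dproj p v) := by
  obtain ⟨k, hp, hk⟩ := exists_dproj_eq_shear_neg p
  have hx : lift (proj p) 0 = p 0 + -(k 0) := by
    conv_rhs => rw [hp]
    simp [coordMul]
  rw [hk, hk, coordJ_shear hx]

/-- The frame `e₁, …, e₆` of the tangent bundle of `G × ℂ`, in the coordinates `p` of `G`. -/
noncomputable def coordFrame (p : Fin 4 → ℝ) : Fin 6 → (Fin 4 → ℝ) × ℂ :=
  ![(field 0 p, 0), (field 1 p, 0), (field 2 p, 0), (field 3 p, 0), (0, 1), (0, Complex.I)]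

theorem eq_sum_smul_coordFrame (p v : Fin 4 → ℝ) (s : ℂ) :
    (v, s) = ∑ i, (![v 3, v 0, v 1, v 2 - p 0 * v 1, s.re, s.im] : Fin 6 → ℝ) i •
      coordFrame p i := by
  refine Prod.ext (funext fun j => ?_) (Complex.ext ?_ ?_)
  · fin_cases j <;> simp [coordFrame, field, Fin.sum_univ_succ]
    ring
  · simp [coordFrame, Fin.sum_univ_succ]
  · simp [coordFrame, Fin.sum_univ_succ]

theorem apply_eq_of_matrixJ {p : Fin 4 → ℝ} {t : ℂ}
    {T : ((Fin 4 → ℝ) × ℂ) →ₗ[ℝ] ((Fin 4 → ℝ) × ℂ)}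
    (hT : ∀ i, T (coordFrame p i) = ∑ j, matrixJ t j i • coordFrame p j)
    (v : Fin 4 → ℝ) (s : ℂ) : T (v, s) = (coordJ t p v, Complex.I * s) := by
  rw [eq_sum_smul_coordFrame p v s, map_sum]
  simp only [map_smul, hT]
  refine Prod.ext (funext fun j => ?_) (Complex.ext ?_ ?_)
  · fin_cases j <;> simp [coordFrame, field, Fin.sum_univ_succ, matrixJ, coordJ] <;> ring
  · simp [coordFrame, Fin.sum_univ_succ, matrixJ]
  · simp [coordFrame, Fin.sum_univ_succ, matrixJ]

theorem totalJ_apply (x : KT × Δ) (v : Fin 4 → ℝ) (s : ℂ) :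
    totalJ x ((v, s) : (Fin 4 → ℝ) × ℂ) =
      ((coordJ x.2 (lift x.1) v, Complex.I * s) : (Fin 4 → ℝ) × ℂ) := by
  refine apply_eq_of_matrixJ (T := Matrix.toLin (totalBasis x) (totalBasis x) (matrixJ x.2))
    (fun i => ?_) v s
  have h := Matrix.toLin_self (totalBasis x) (totalBasis x) (matrixJ x.2) i
  rw [coe_totalBasis] at h
  exact h

end CoordinateFormula

section TotalSpace

theorem coe_extChartAt_Δ (t : Δ) : ⇑(extChartAt 𝓘(ℝ, ℂ) t) = Subtype.val := by
  ext s
  simp [TopologicalSpace.Opens.chartAt_eq, chartAt_self_eq]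

theorem hasMFDerivAt_val (t : Δ) :
    HasMFDerivAt 𝓘(ℝ, ℂ) 𝓘(ℝ, ℂ) (Subtype.val : Δ → ℂ) t (ContinuousLinearMap.id ℝ ℂ) := by
  have h := (mdifferentiableAt_extChartAt (I := 𝓘(ℝ, ℂ)) (mem_chart_source _ t)).hasMFDerivAt
  rwa [mfderiv_extChartAt_self, coe_extChartAt_Δ] at h

theorem coe_extChartAt_prod (x : KT × Δ) :
    ⇑(extChartAt (𝓘(ℝ, Fin 4 → ℝ).prod 𝓘(ℝ, ℂ)) x) =
      fun q : KT × Δ => (extChartAt 𝓘(ℝ, Fin 4 → ℝ) x.1 q.1, (q.2 : ℂ)) := by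
  rw [extChartAt_prod, PartialEquiv.prod_coe, coe_extChartAt_Δ]

theorem extChartAt_prod_proj {x : KT × Δ} {y : Fin 4 → ℝ}
    (hy : y ∈ Metric.ball (lift x.1) (1 / 2)) (t : Δ) :
    extChartAt (𝓘(ℝ, Fin 4 → ℝ).prod 𝓘(ℝ, ℂ)) x (proj y, t) = (y, (t : ℂ)) := by
  simp only [coe_extChartAt_prod, extChartAt_eq, chart_proj hy]

theorem mfderiv_extChartAt_prod_dproj {x : KT × Δ} {y : Fin 4 → ℝ}
    (hy : y ∈ Metric.ball (lift x.1) (1 / 2)) (t : Δ) (v : Fin 4 → ℝ) (s : ℂ) :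
    mfderiv (𝓘(ℝ, Fin 4 → ℝ).prod 𝓘(ℝ, ℂ)) 𝓘(ℝ, (Fin 4 → ℝ) × ℂ)
      (extChartAt (𝓘(ℝ, Fin 4 → ℝ).prod 𝓘(ℝ, ℂ)) x) (proj y, t)
      ((dproj y v, s) : (Fin 4 → ℝ) × ℂ) = ((v, s) : (Fin 4 → ℝ) × ℂ) := by
  have hfst := HasMFDerivAt.comp (proj y, t) (mdifferentiableAt_extChartAt
    (I := 𝓘(ℝ, Fin 4 → ℝ)) (proj_mem_chartAt_source hy)).hasMFDerivAt
    (hasMFDerivAt_fst (I' := 𝓘(ℝ, ℂ)) (proj y, t))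
  have hsnd := HasMFDerivAt.comp (proj y, t) (hasMFDerivAt_val t)
    (hasMFDerivAt_snd (I := 𝓘(ℝ, Fin 4 → ℝ)) (proj y, t))
  have hprod : HasMFDerivAt (𝓘(ℝ, Fin 4 → ℝ).prod 𝓘(ℝ, ℂ)) 𝓘(ℝ, (Fin 4 → ℝ) × ℂ)
      (fun q : KT × Δ => (extChartAt 𝓘(ℝ, Fin 4 → ℝ) x.1 q.1, (q.2 : ℂ))) (proj y, t) _ :=
    ⟨hfst.1.prodMk hsnd.1, hfst.2.prodMk hsnd.2⟩
  rw [coe_extChartAt_prod, hprod.mfderiv]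
  exact Prod.ext (mfderiv_extChartAt_dproj hy v) rfl

theorem contDiffAt_coordJ {q : ((Fin 4 → ℝ) × ℂ) × ((Fin 4 → ℝ) × ℂ)}
    (hq : q.1.2.re + Real.pi ≠ 0) :
    ContDiffAt ℝ ∞ (fun q : ((Fin 4 → ℝ) × ℂ) × ((Fin 4 → ℝ) × ℂ) =>
      (coordJ q.1.2 q.1.1 q.2.1, Complex.I * q.2.2)) q := by
  have hre : ContDiff ℝ ∞ Complex.re := Complex.reCLM.contDiff
  have him : ContDiff ℝ ∞ Complex.im := Complex.imCLM.contDiff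
  refine ContDiffAt.prodMk (contDiffAt_pi.2 fun j => ?_) (by fun_prop)
  simp only [coordJ, norm_add_pi_sq]
  fin_cases j <;> simp only [Fin.zero_eta, Fin.mk_one, Fin.reduceFinMk, Matrix.cons_val] <;>
    fun_prop (disch := assumption)

theorem contMDiff_totalJ : ContMDiff (𝓘(ℝ, Fin 4 → ℝ).prod 𝓘(ℝ, ℂ)).tangent
    (𝓘(ℝ, Fin 4 → ℝ).prod 𝓘(ℝ, ℂ)).tangent ∞
    (fun v : TangentBundle (𝓘(ℝ, Fin 4 → ℝ).prod 𝓘(ℝ, ℂ)) (KT × Δ) =>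
      (⟨v.1, totalJ v.1 v.2⟩ : TangentBundle (𝓘(ℝ, Fin 4 → ℝ).prod 𝓘(ℝ, ℂ)) (KT × Δ))) := by
  refine contMDiff_tangentBundle_of_mfderiv_extChartAt
    (I := 𝓘(ℝ, Fin 4 → ℝ).prod 𝓘(ℝ, ℂ)) (T := fun x => totalJ x)
    (a := fun _ q => (coordJ q.1.2 q.1.1 q.2.1, Complex.I * q.2.2))
    (fun x v => contDiffAt_coordJ ?_) (fun x₀ => ?_)
  · rw [coe_extChartAt_prod]
    exact (Δ_re_add_pi_pos x.2).ne'
  · filter_upwards [((chart (lift x₀.1)).open_source.preimage continuous_fst).mem_nhds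
      (mem_chart_source (Fin 4 → ℝ) x₀.1)]
    rintro ⟨_, t⟩ ⟨y, hy, rfl⟩ ⟨w, s⟩
    obtain ⟨v, rfl⟩ := dproj_surjective y w
    rw [totalJ_apply, ← dproj_coordJ, mfderiv_extChartAt_prod_dproj hy,
      mfderiv_extChartAt_prod_dproj hy, extChartAt_prod_proj hy]

theorem isAlmostComplexStructure_totalJ :
    IsAlmostComplexStructure (𝓘(ℝ, Fin 4 → ℝ).prod 𝓘(ℝ, ℂ)) totalJ where
  sq_eq_neg := by
    rintro x ⟨v, s⟩
    refine (congrArg (totalJ x) (totalJ_apply x v s)).trans ((totalJ_apply x _ _).trans ?_)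
    rw [coordJ_coordJ, ← mul_assoc, Complex.I_mul_I, neg_one_mul]
    rfl
  smooth := contMDiff_totalJ

theorem isPseudoholomorphic_snd :
    IsPseudoholomorphic (𝓘(ℝ, Fin 4 → ℝ).prod 𝓘(ℝ, ℂ)) 𝓘(ℝ, ℂ)
      totalJ stdJ (Prod.snd : KT × Δ → Δ) where
  smooth := contMDiff_snd
  comm := by
    rintro x ⟨v, s⟩
    rw [mfderiv_snd]
    exact congrArg Prod.snd (totalJ_apply x v s)

end TotalSpace

section Fibres

variable (t : Δ)

theorem contMDiff_fibreIncl :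
    ContMDiff 𝓘(ℝ, Fin 4 → ℝ) (𝓘(ℝ, Fin 4 → ℝ).prod 𝓘(ℝ, ℂ)) ∞ (fibreIncl t) :=
  contMDiff_id.prodMk contMDiff_const

theorem mfderiv_fibreIncl (m : KT) :
    mfderiv 𝓘(ℝ, Fin 4 → ℝ) (𝓘(ℝ, Fin 4 → ℝ).prod 𝓘(ℝ, ℂ)) (fibreIncl t) m =
      ContinuousLinearMap.inl ℝ (Fin 4 → ℝ) ℂ :=
  mfderiv_prod_left

theorem fibreJ_apply (m : KT) (v : Fin 4 → ℝ) : fibreJ t m v = coordJ t (lift m) v := by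
  have hfst : mfderiv (𝓘(ℝ, Fin 4 → ℝ).prod 𝓘(ℝ, ℂ)) 𝓘(ℝ, Fin 4 → ℝ) Prod.fst
      (fibreIncl t m) = ContinuousLinearMap.fst ℝ (Fin 4 → ℝ) ℂ := mfderiv_fst
  rw [fibreJ, mfderiv_fibreIncl, hfst]
  exact congrArg Prod.fst (totalJ_apply (fibreIncl t m) v 0)

theorem fibreJ_dproj (p v : Fin 4 → ℝ) :
    fibreJ t (proj p) (dproj p v) = dproj p (coordJ t p v) :=
  (fibreJ_apply t (proj p) (dproj p v)).trans (dproj_coordJ t p v).symm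

theorem isAlmostComplexStructure_fibreJ :
    IsAlmostComplexStructure 𝓘(ℝ, Fin 4 → ℝ) (fibreJ t) where
  sq_eq_neg := fun m v => (congrArg (fibreJ t m) (fibreJ_apply t m v)).trans
    ((fibreJ_apply t m _).trans (coordJ_coordJ t _ v))
  smooth :=
    ((contMDiff_fst (I := 𝓘(ℝ, Fin 4 → ℝ)) (J := 𝓘(ℝ, ℂ)) (M := KT) (N := Δ)
      (n := ∞)).contMDiff_tangentMap (m := ∞) le_rfl).comp
      (contMDiff_totalJ.comp ((contMDiff_fibreIncl t).contMDiff_tangentMap (m := ∞) le_rfl))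

theorem isPseudoholomorphic_fibreIncl :
    IsPseudoholomorphic 𝓘(ℝ, Fin 4 → ℝ) (𝓘(ℝ, Fin 4 → ℝ).prod 𝓘(ℝ, ℂ))
      (fibreJ t) totalJ (fibreIncl t) where
  smooth := contMDiff_fibreIncl t
  comm := by
    intro m v
    rw [mfderiv_fibreIncl]
    refine Eq.trans ?_ (totalJ_apply (fibreIncl t m) v 0).symm
    rw [mul_zero]
    exact Prod.ext (fibreJ_apply t m v) rfl

variable {t} in
theorem dbarFun_dproj {f : KT → ℂ} {p : Fin 4 → ℝ}
    (hf : MDifferentiableAt 𝓘(ℝ, Fin 4 → ℝ) 𝓘(ℝ, ℂ) f (proj p)) (v : Fin 4 → ℝ) :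
    dbarFun (fibreJ t) f (proj p) (dproj p v) =
      1 / 2 * (fderiv ℝ (f ∘ proj) p v + Complex.I * fderiv ℝ (f ∘ proj) p (coordJ t p v)) := by
  refine congrArg₂ (fun a b => (1 / 2 : ℂ) * (a + Complex.I * b)) (diffFun_dproj hf v) ?_
  exact (congrArg (diffFun f (proj p)) (fibreJ_dproj t p v)).trans (diffFun_dproj hf _)

end Fibres

section Coframe

/-- The covector `e¹ + i e²` of type `(1, 0)`. -/
noncomputable def φ₁ : (Fin 4 → ℝ) →L[ℝ] ℂ :=
  Complex.ofRealCLM.comp (ContinuousLinearMap.proj 3) +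
    Complex.I • Complex.ofRealCLM.comp (ContinuousLinearMap.proj 0)

theorem φ₁_apply (v : Fin 4 → ℝ) : φ₁ v = v 3 + Complex.I * v 0 := by
  simp [φ₁]

/-- The coefficient of `e⁴` in the covector `φ₂` of type `(1, 0)`. -/
noncomputable def κ (t : ℂ) : ℂ := t.im + Complex.I * (t.re + Real.pi)

/-- The covector `e³ + κ e⁴` of type `(1, 0)` for the structure over `t`, at the point of `G` with
coordinates `p`. -/
noncomputable def φ₂ (t : ℂ) (p : Fin 4 → ℝ) : (Fin 4 → ℝ) →L[ℝ] ℂ :=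
  (1 - p 0 * κ t) • Complex.ofRealCLM.comp (ContinuousLinearMap.proj 1) +
    κ t • Complex.ofRealCLM.comp (ContinuousLinearMap.proj 2)

theorem φ₂_apply (t : ℂ) (p v : Fin 4 → ℝ) : φ₂ t p v = v 1 + κ t * (v 2 - p 0 * v 1) := by
  simp [φ₂]
  ring

theorem φ₁_coordJ (t : ℂ) (p v : Fin 4 → ℝ) : φ₁ (coordJ t p v) = Complex.I * φ₁ v := by
  simp only [φ₁_apply, coordJ, Matrix.cons_val, Complex.ofReal_neg]
  linear_combination -(v 0 : ℂ) * Complex.I_sq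

theorem φ₂_coordJ (t : Δ) (p v : Fin 4 → ℝ) :
    φ₂ t p (coordJ t p v) = Complex.I * φ₂ t p v := by
  have h : ((t : ℂ).re + Real.pi : ℂ) ≠ 0 := by exact_mod_cast (Δ_re_add_pi_pos t).ne'
  simp only [φ₂_apply, κ, coordJ, norm_add_pi_sq, Matrix.cons_val]
  push_cast
  field_simp
  linear_combination -((t : ℂ).re + Real.pi : ℂ) ^ 2 * (v 2 - p 0 * v 1) * Complex.I_sq

theorem φ₁_dproj (p v : Fin 4 → ℝ) : φ₁ (dproj p v) = φ₁ v := by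
  obtain ⟨k, -, h⟩ := exists_dproj_eq_shear_neg p
  simp [φ₁_apply, h, shear_apply]

theorem φ₂_dproj (t : ℂ) (p v : Fin 4 → ℝ) : φ₂ t (lift (proj p)) (dproj p v) = φ₂ t p v := by
  obtain ⟨k, hp, h⟩ := exists_dproj_eq_shear_neg p
  have hx : p 0 = k 0 + lift (proj p) 0 := by
    conv_lhs => rw [hp]
    simp [coordMul]
  simp only [φ₂_apply, h, shear_apply, hx, Matrix.cons_val]
  push_cast
  ring

theorem φ₁_field_zero (p : Fin 4 → ℝ) : φ₁ (field 0 p) = 1 := by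
  simp [φ₁_apply, field]

theorem φ₁_field_two (p : Fin 4 → ℝ) : φ₁ (field 2 p) = 0 := by
  simp [φ₁_apply, field]

theorem φ₂_field_two (t : ℂ) (p : Fin 4 → ℝ) : φ₂ t p (field 2 p) = 1 := by
  simp [φ₂_apply, field]

theorem eq_sum_smul_field_coordJ (t : Δ) (p v : Fin 4 → ℝ) :
    v = v 3 • field 0 p + v 0 • coordJ t p (field 0 p) +
      (v 1 + (t : ℂ).im * (v 2 - p 0 * v 1)) • field 2 p +
      (((t : ℂ).re + Real.pi) * (v 2 - p 0 * v 1)) • coordJ t p (field 2 p) := by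
  have h := (Δ_re_add_pi_pos t).ne'
  funext j
  fin_cases j <;> simp [coordJ, field]
  all_goals field_simp
  all_goals ring

theorem apply_eq_φ₁_mul_add_φ₂_mul {t : Δ} {p : Fin 4 → ℝ} {ℓ : (Fin 4 → ℝ) →ₗ[ℝ] ℂ}
    (hℓ : ∀ v, ℓ (coordJ t p v) = Complex.I * ℓ v) (v : Fin 4 → ℝ) :
    ℓ v = φ₁ v * ℓ (field 0 p) + φ₂ t p v * ℓ (field 2 p) := by
  conv_lhs => rw [eq_sum_smul_field_coordJ t p v]
  simp only [map_add, map_smul, hℓ, Complex.real_smul, φ₁_apply, φ₂_apply, κ]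
  push_cast
  ring

end Coframe

section CanonicalForm

/-- The exterior product of two complex valued covectors, normalised so that
`(α ∧ β)(u, v) = α u * β v - α v * β u`. -/
noncomputable def wedge {E : Type*} [NormedAddCommGroup E] [NormedSpace ℝ E] (α β : E →L[ℝ] ℂ) :
    E [⋀^Fin 2]→L[ℝ] ℂ :=
  ContinuousAlternatingMap.alternatizeUncurryFin
    (α.smulRight (ContinuousAlternatingMap.ofSubsingleton ℝ E ℂ (0 : Fin 1) β))

theorem wedge_apply {E : Type*} [NormedAddCommGroup E] [NormedSpace ℝ E] (α β : E →L[ℝ] ℂ)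
    (w : Fin 2 → E) :
    wedge α β w = α (w 0) * β (w 1) - α (w 1) * β (w 0) := by
  simp [wedge, ContinuousAlternatingMap.alternatizeUncurryFin_apply, Fin.sum_univ_succ,
    Fin.removeNth]
  ring

/-- The left invariant form `φ₁ ∧ φ₂` of type `(2, 0)` on `G`, for the structure over `t`. -/
noncomputable def canonicalForm (t : ℂ) (p : Fin 4 → ℝ) : (Fin 4 → ℝ) [⋀^Fin 2]→L[ℝ] ℂ :=
  wedge φ₁ (φ₂ t p)

theorem canonicalForm_apply (t : ℂ) (p : Fin 4 → ℝ) (w : Fin 2 → Fin 4 → ℝ) :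
    canonicalForm t p w = φ₁ (w 0) * φ₂ t p (w 1) - φ₁ (w 1) * φ₂ t p (w 0) :=
  wedge_apply φ₁ (φ₂ t p) w

theorem canonicalForm_field (t : ℂ) (p : Fin 4 → ℝ) :
    canonicalForm t p ![field 0 p, field 2 p] = 1 := by
  simp [canonicalForm_apply, φ₁_field_zero, φ₁_field_two, φ₂_field_two]

theorem canonicalForm_update_coordJ (t : Δ) (p : Fin 4 → ℝ) (w : Fin 2 → Fin 4 → ℝ) (i : Fin 2) :
    canonicalForm t p (Function.update w i (coordJ t p (w i))) =
      Complex.I * canonicalForm t p w := by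
  rw [canonicalForm_apply, canonicalForm_apply]
  fin_cases i <;> simp [φ₁_coordJ, φ₂_coordJ] <;> ring

theorem apply_vec_swap {E F : Type*} [NormedAddCommGroup E] [NormedSpace ℝ E]
    [NormedAddCommGroup F] [NormedSpace ℝ F] (A : E [⋀^Fin 2]→L[ℝ] F) (a b : E) :
    A ![b, a] = -A ![a, b] := by
  have h := A.toAlternatingMap.map_swap ![a, b] (zero_ne_one : (0 : Fin 2) ≠ 1)
  have hswap : ![a, b] ∘ Equiv.swap (0 : Fin 2) 1 = ![b, a] := by
    funext i
    fin_cases i <;> simp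
  rwa [hswap] at h

theorem apply_cons_eq_φ₁_mul_add_φ₂_mul {t : Δ} {p : Fin 4 → ℝ}
    {A : (Fin 4 → ℝ) [⋀^Fin 2]→L[ℝ] ℂ}
    (hA : ∀ w i, A (Function.update w i (coordJ t p (w i))) = Complex.I * A w)
    (a b : Fin 4 → ℝ) :
    A ![a, b] = φ₁ b * A ![a, field 0 p] + φ₂ t p b * A ![a, field 2 p] := by
  have hupdate (u v : Fin 4 → ℝ) : Function.update ![a, u] 1 v = ![a, v] := by
    funext i
    fin_cases i <;> rfl
  have hℓ (v : Fin 4 → ℝ) : A.toMultilinearMap.toLinearMap ![a, 0] 1 v = A ![a, v] :=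
    congrArg A (hupdate 0 v)
  have h := apply_eq_φ₁_mul_add_φ₂_mul (p := p) (ℓ := A.toMultilinearMap.toLinearMap ![a, 0] 1)
    (fun v => by rw [hℓ, hℓ, ← hA ![a, v] 1, hupdate]; rfl) b
  rwa [hℓ, hℓ, hℓ] at h

theorem eq_smul_canonicalForm {t : Δ} {p : Fin 4 → ℝ} {A : (Fin 4 → ℝ) [⋀^Fin 2]→L[ℝ] ℂ}
    (hA : ∀ w i, A (Function.update w i (coordJ t p (w i))) = Complex.I * A w) :
    A = A ![field 0 p, field 2 p] • canonicalForm t p := by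
  have hdiag (a : Fin 4 → ℝ) : A ![a, a] = 0 :=
    A.map_eq_zero_of_eq ![a, a] (i := 0) (j := 1) rfl zero_ne_one
  have hexp := apply_cons_eq_φ₁_mul_add_φ₂_mul hA
  ext w
  have hw : w = ![w 0, w 1] := by
    funext i
    fin_cases i <;> rfl
  rw [hw, hexp, apply_vec_swap A (field 0 p), apply_vec_swap A (field 2 p), hexp (field 0 p),
    hexp (field 2 p), hdiag, hdiag, apply_vec_swap A (field 0 p)]
  simp only [ContinuousAlternatingMap.smul_apply, canonicalForm_apply, Matrix.cons_val,
    smul_eq_mul]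
  ring

theorem canonicalForm_eq_add_smul (t : ℂ) (p : Fin 4 → ℝ) :
    canonicalForm t p = wedge φ₁ (φ₂ t 0) +
      p 0 • wedge φ₁ (-κ t • Complex.ofRealCLM.comp (ContinuousLinearMap.proj 1)) := by
  ext w
  simp [canonicalForm_apply, wedge_apply, φ₂_apply]
  ring

theorem hasFDerivAt_canonicalForm (t : ℂ) (p : Fin 4 → ℝ) :
    HasFDerivAt (canonicalForm t)
      ((ContinuousLinearMap.proj (R := ℝ) (φ := fun _ : Fin 4 => ℝ) 0).smulRight
        (wedge φ₁ (-κ t • Complex.ofRealCLM.comp (ContinuousLinearMap.proj 1)))) p := by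
  rw [funext (canonicalForm_eq_add_smul t)]
  exact ((hasFDerivAt_apply 0 p).smul_const _).const_add _

theorem contDiff_canonicalForm (t : ℂ) : ContDiff ℝ ∞ (canonicalForm t) := by
  rw [funext (canonicalForm_eq_add_smul t)]
  fun_prop

theorem extDeriv_canonicalForm_apply (t : ℂ) (p a b c : Fin 4 → ℝ) :
    extDeriv (canonicalForm t) p ![a, b, c] =
      -κ t * (a 0 * (φ₁ b * c 1 - φ₁ c * b 1) - b 0 * (φ₁ a * c 1 - φ₁ c * a 1) +
        c 0 * (φ₁ a * b 1 - φ₁ b * a 1)) := by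
  rw [extDeriv, (hasFDerivAt_canonicalForm t p).fderiv,
    ContinuousAlternatingMap.alternatizeUncurryFin_apply]
  simp [Fin.sum_univ_succ, wedge_apply, Fin.removeNth, Fin.succAbove]
  ring

end CanonicalForm

section CanonicalSection

/-- The form on `M` induced by `φ₁ ∧ φ₂`, a global frame of the canonical bundle of the fibre over
`t`. -/
noncomputable def canonicalSection (t : ℂ) (m : KT) : FormFibre (Fin 4 → ℝ) 2 m :=
  canonicalForm t (lift m)

theorem formInChart_canonicalSection (t : ℂ) (m : KT) :
    formInChart (canonicalSection t) m = canonicalForm t := by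
  have hsymm : ⇑(extChartAt 𝓘(ℝ, Fin 4 → ℝ) m).symm = proj := rfl
  funext y
  ext w
  rw [formInChart, hsymm, canonicalForm_apply]
  refine (canonicalForm_apply t (lift (proj y)) (fun i => dproj y (w i))).trans ?_
  simp only [φ₁_dproj, φ₂_dproj]

variable {t : Δ}

theorem eq_smul_canonicalSection {m : KT} {A : FormFibre (Fin 4 → ℝ) 2 m}
    (hA : IsTypeZero (fibreJ t) m A) :
    A = A (![field 0 (lift m), field 2 (lift m)] : Fin 2 → Fin 4 → ℝ) • canonicalSection t m :=
  eq_smul_canonicalForm fun w i =>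
    (congrArg (fun v => A (Function.update w i v)) (fibreJ_apply t m (w i)).symm).trans (hA w i)

theorem canonicalSection_ne_zero (m : KT) : canonicalSection t m ≠ 0 := fun h =>
  zero_ne_one ((DFunLike.congr_fun h _).symm.trans (canonicalForm_field t (lift m)))

theorem isCanonicalFrameOn_canonicalSection :
    IsCanonicalFrameOn (fibreJ t) (canonicalSection t) univ where
  smooth := fun m => by
    rw [formInChart_canonicalSection]
    exact (contDiff_canonicalForm t).contDiffOn
  type_zero := fun m _ w i =>
    (congrArg (fun v => canonicalForm t (lift m) (Function.update w i v))
      (fibreJ_apply t m (w i))).trans (canonicalForm_update_coordJ t (lift m) w i)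
  ne_zero := fun m _ => canonicalSection_ne_zero m

theorem exists_eq_smul_of_isTypeZero {m : KT} {A B : FormFibre (Fin 4 → ℝ) 2 m}
    (hA : IsTypeZero (fibreJ t) m A) (hB : IsTypeZero (fibreJ t) m B) (hB0 : B ≠ 0) :
    ∃ c : ℂ, A = c • B := by
  obtain ⟨a, rfl⟩ : ∃ a : ℂ, A = a • canonicalSection t m := ⟨_, eq_smul_canonicalSection hA⟩
  obtain ⟨b, rfl⟩ : ∃ b : ℂ, B = b • canonicalSection t m := ⟨_, eq_smul_canonicalSection hB⟩
  have hb : b ≠ 0 := by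
    rintro rfl
    exact hB0 (zero_smul ℂ (canonicalSection t m))
  exact ⟨a / b, by rw [smul_smul, div_mul_cancel₀ a hb]⟩

/-- The constant `c` with `∂̄(φ₁ ∧ φ₂) = c φ̄₁ ⊗ (φ₁ ∧ φ₂)`. -/
noncomputable def dbarConst (t : ℂ) : ℝ := ‖t + Real.pi‖ ^ 2 / (4 * (t.re + Real.pi))

theorem projTypeZero_fibreJ_apply (m : KT) (A : (Fin 4 → ℝ) [⋀^Fin 2]→L[ℝ] ℂ)
    (a b : Fin 4 → ℝ) :
    projTypeZero (fibreJ t) m A (![a, b] : Fin 2 → Fin 4 → ℝ) =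
      1 / 4 * (A ![a, b] - Complex.I * A ![coordJ t (lift m) a, b] -
        Complex.I * A ![a, coordJ t (lift m) b] -
        A ![coordJ t (lift m) a, coordJ t (lift m) b]) := by
  have h := projTypeZero_apply_vec_two (J := fibreJ t) (x := m) A a b
  rw [fibreJ_apply, fibreJ_apply] at h
  exact h

theorem dbarForm_canonicalSection_eq_projTypeZero (m : KT) (v : Fin 4 → ℝ) :
    dbarForm (fibreJ t) (canonicalSection t) m v = projTypeZero (fibreJ t) m
      ((1 / 2 : ℂ) • ((extDeriv (canonicalForm t) (lift m)).curryLeft v + Complex.I •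
        (extDeriv (canonicalForm t) (lift m)).curryLeft (coordJ t (lift m) v))) := by
  have hη : extDerivAt (canonicalSection t) m = extDeriv (canonicalForm t) (lift m) := by
    rw [extDerivAt_eq, formInChart_canonicalSection, extChartAt_self]
  exact congrArg₂ (fun (η : (Fin 4 → ℝ) [⋀^Fin 3]→L[ℝ] ℂ) (u : Fin 4 → ℝ) =>
    projTypeZero (fibreJ t) m ((1 / 2 : ℂ) • (η.curryLeft v + Complex.I • η.curryLeft u)))
    hη (fibreJ_apply t m v)

theorem dbarForm_canonicalSection_apply (m : KT) (v : Fin 4 → ℝ) :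
    dbarForm (fibreJ t) (canonicalSection t) m v
        (![field 0 (lift m), field 2 (lift m)] : Fin 2 → Fin 4 → ℝ) =
      dbarConst t * starRingEnd ℂ (φ₁ v) := by
  have hre : ((t : ℂ).re + Real.pi : ℂ) ≠ 0 := by exact_mod_cast (Δ_re_add_pi_pos t).ne'
  have hcurry (c : ℂ) (u w a b : Fin 4 → ℝ) (η : (Fin 4 → ℝ) [⋀^Fin 3]→L[ℝ] ℂ) :
      (c • (η.curryLeft u + Complex.I • η.curryLeft w)) ![a, b] =
        c * (η ![u, a, b] + Complex.I * η ![w, a, b]) := rfl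
  rw [dbarForm_canonicalSection_eq_projTypeZero, projTypeZero_fibreJ_apply]
  simp only [hcurry, extDeriv_canonicalForm_apply, φ₁_coordJ, φ₁_field_zero, φ₁_field_two]
  simp only [φ₁_apply, coordJ, field, κ, dbarConst, norm_add_pi_sq, Matrix.cons_val]
  simp only [map_add, map_mul, Complex.conj_ofReal, Complex.conj_I]
  push_cast
  field_simp
  set a : ℂ := Complex.ofReal (t : ℂ).re + Real.pi
  set b : ℂ := Complex.ofReal (t : ℂ).im
  linear_combination (-a * b * (Complex.I * v 3 + v 0) + b ^ 2 * (Complex.I * v 0 - v 3) +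
    a ^ 2 * (Complex.I * (1 - Complex.I ^ 2) * v 0 - 2 * v 3)) * Complex.I_sq

theorem dbarForm_canonicalSection (m : KT) (v : Fin 4 → ℝ) :
    dbarForm (fibreJ t) (canonicalSection t) m v =
      (dbarConst t * starRingEnd ℂ (φ₁ v)) • canonicalSection t m := by
  rw [← dbarForm_canonicalSection_apply]
  exact eq_smul_canonicalSection
    (isTypeZero_dbarForm ((isAlmostComplexStructure_fibreJ t).sq_eq_neg m) _ v)

end CanonicalSection

section PluricanonicalSections

/-- Every point `p` is joined to `0` by a pseudoholomorphic plane tangent to `e₃` through `p` and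
one tangent to `e₁` through `0`; Liouville's theorem applies to the restriction of `H` to both. -/
theorem apply_eq_apply_zero {t : Δ} {H : (Fin 4 → ℝ) → ℂ} (hH : Differentiable ℝ H)
    (hbounded : Bornology.IsBounded (range H))
    (hholomorphic : ∀ p v, fderiv ℝ H p (coordJ t p v) = Complex.I * fderiv ℝ H p v)
    (p : Fin 4 → ℝ) : H p = H 0 := by
  set q : Fin 4 → ℝ := ![p 0, 0, 0, p 3] with hq
  have hp : p = q + (p 1 + (t : ℂ).im * (p 2 - p 0 * p 1)) • field 2 q +
      (((t : ℂ).re + Real.pi) * (p 2 - p 0 * p 1)) • coordJ t q (field 2 q) := by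
    have h := eq_sum_smul_field_coordJ t q p
    rwa [show p 3 • field 0 q + p 0 • coordJ t q (field 0 q) = q by
      rw [coordJ_field_zero, hq]; funext i; fin_cases i <;> simp [field]] at h
  have hq0 : q = 0 + p 3 • field 0 0 + p 0 • coordJ t 0 (field 0 0) := by
    rw [coordJ_field_zero, hq]
    funext i
    fin_cases i <;> simp [field]
  have h₃ : H p = H q := by
    conv_lhs => rw [hp]
    refine apply_add_eq_of_isBounded_range hH hbounded (fun a b => ?_) _ _
    rw [← hholomorphic]
    refine congrArg _ (coordJ_congr ?_)
    simp [coordJ_apply_zero, show field 2 q 0 = 0 from rfl, show field 2 q 3 = 0 from rfl]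
  have h₁ : H q = H 0 := by
    rw [hq0]
    refine apply_add_eq_of_isBounded_range hH hbounded (fun a b => ?_) _ _
    rw [← hholomorphic, coordJ_field_zero, coordJ_field_zero]
  rw [h₃, h₁]

theorem hasFDerivAt_exp_coord (c : ℂ) (p : Fin 4 → ℝ) :
    HasFDerivAt (fun q : Fin 4 → ℝ => Complex.exp (c * q 0))
      ((ContinuousLinearMap.proj (R := ℝ) (φ := fun _ : Fin 4 => ℝ) 0).smulRight
        (c * Complex.exp (c * p 0))) p := by
  have hlinear : HasFDerivAt (fun q : Fin 4 → ℝ => c * (q 0 : ℂ))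
      ((ContinuousLinearMap.proj (R := ℝ) (φ := fun _ : Fin 4 => ℝ) 0).smulRight c) p := by
    simpa [mul_comm] using
      (hasFDerivAt_apply (𝕜 := ℝ) (F' := fun _ : Fin 4 => ℝ) 0 p).smul_const c
  refine hlinear.cexp.congr_fderiv ?_
  ext v
  simp
  ring

theorem fderiv_mul_exp_add_I_mul {t : ℂ} {F : (Fin 4 → ℝ) → ℂ} {p : Fin 4 → ℝ}
    (hF : DifferentiableAt ℝ F p) (μ : ℝ) (v : Fin 4 → ℝ) :
    fderiv ℝ (fun q => F q * Complex.exp (-(μ * Complex.I) * q 0)) p v +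
        Complex.I * fderiv ℝ (fun q => F q * Complex.exp (-(μ * Complex.I) * q 0)) p
          (coordJ t p v) =
      (fderiv ℝ F p v + Complex.I * fderiv ℝ F p (coordJ t p v) +
        μ * starRingEnd ℂ (φ₁ v) * F p) * Complex.exp (-(μ * Complex.I) * p 0) := by
  have hconj : starRingEnd ℂ (φ₁ v) = v 3 - Complex.I * v 0 := by
    rw [φ₁_apply]
    simp
    ring
  have hderiv := (hF.hasFDerivAt.mul (hasFDerivAt_exp_coord (-(μ * Complex.I)) p)).fderiv
  rw [Pi.mul_def] at hderiv
  rw [hderiv, hconj]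
  simp only [add_apply, smul_apply, ContinuousLinearMap.smulRight_apply,
    ContinuousLinearMap.proj_apply, coordJ_apply_zero, smul_eq_mul, Complex.real_smul]
  linear_combination (-(μ * v 3 * F p * Complex.exp (-(μ * Complex.I) * p 0)) : ℂ) * Complex.I_sq

theorem dbar_add_smul_eq_zero_iff {t : Δ} {F : (Fin 4 → ℝ) → ℂ} (hF : Differentiable ℝ F)
    (hbounded : Bornology.IsBounded (range F)) (μ : ℝ) :
    (∀ p v, fderiv ℝ F p v + Complex.I * fderiv ℝ F p (coordJ t p v) +
        μ * starRingEnd ℂ (φ₁ v) * F p = 0) ↔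
      ∃ a : ℂ, ∀ p, F p = a * Complex.exp (μ * p 0 * Complex.I) := by
  set H : (Fin 4 → ℝ) → ℂ := fun q => F q * Complex.exp (-(μ * Complex.I) * q 0) with hH
  have hexp (p : Fin 4 → ℝ) :
      Complex.exp (μ * p 0 * Complex.I) = (Complex.exp (-(μ * Complex.I) * p 0))⁻¹ := by
    rw [← Complex.exp_neg]
    ring_nf
  have hFH (a : ℂ) (p : Fin 4 → ℝ) : F p = a * Complex.exp (μ * p 0 * Complex.I) ↔ H p = a := by
    rw [hexp, eq_mul_inv_iff_mul_eq₀ (Complex.exp_ne_zero _)]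
  have hdbar (p v : Fin 4 → ℝ) := fderiv_mul_exp_add_I_mul (t := (t : ℂ)) (hF p) μ v
  simp only [hFH]
  constructor
  · intro h
    have hHbounded : Bornology.IsBounded (range H) := by
      have hnorm (p : Fin 4 → ℝ) : ‖H p‖ = ‖F p‖ := by
        rw [norm_mul, Complex.norm_exp]
        simp
      obtain ⟨C, hC⟩ := hbounded.exists_norm_le
      refine isBounded_iff_forall_norm_le.2 ⟨C, forall_mem_range.2 fun p => ?_⟩
      exact (hnorm p).trans_le (hC _ (mem_range_self p))
    refine ⟨H 0, apply_eq_apply_zero (t := t)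
      (fun p => (hF p).mul (hasFDerivAt_exp_coord _ p).differentiableAt) hHbounded
      fun p v => ?_⟩
    have hzero := hdbar p v
    rw [h, zero_mul] at hzero
    linear_combination -Complex.I * hzero + fderiv ℝ H p (coordJ t p v) * Complex.I_sq
  · rintro ⟨a, ha⟩ p v
    have hconst : H = fun _ => a := funext ha
    have hzero := (hdbar p v).symm
    rw [← hH, hconst, fderiv_fun_const] at hzero
    simpa using hzero

variable {t : Δ} {k : ℕ}

theorem dbarFun_add_eq_zero_iff {f : KT → ℂ}
    (hf : MDifferentiable 𝓘(ℝ, Fin 4 → ℝ) 𝓘(ℝ, ℂ) f) (c : ℝ) :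
    (∀ (m : KT) (v : Fin 4 → ℝ),
        dbarFun (fibreJ t) f m v + k * (c * starRingEnd ℂ (φ₁ v)) * f m = 0) ↔
      ∀ p v, fderiv ℝ (f ∘ proj) p v + Complex.I * fderiv ℝ (f ∘ proj) p (coordJ t p v) +
        (2 * k * c : ℝ) * starRingEnd ℂ (φ₁ v) * (f ∘ proj) p = 0 := by
  rw [proj_surjective.forall]
  refine forall_congr' fun p => (dproj_surjective p).forall.trans (forall_congr' fun v => ?_)
  rw [dbarFun_dproj (hf _), φ₁_dproj, Function.comp_apply]
  push_cast
  constructor <;> intro h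
  · linear_combination 2 * h
  · linear_combination h / 2

theorem mem_pluricanonicalSections_fibreJ_iff_dbarFun
    {σ : ∀ m : KT, TensorFibre (Fin 4 → ℝ) 2 k m} :
    σ ∈ pluricanonicalSections (fibreJ t) 2 k ↔
      ∃ f : KT → ℂ, ContMDiff 𝓘(ℝ, Fin 4 → ℝ) 𝓘(ℝ, ℂ) ∞ f ∧
        (∀ m, σ m = f m • formPow k (canonicalSection t) m) ∧ ∀ (m : KT) (v : Fin 4 → ℝ),
          dbarFun (fibreJ t) f m v + k * (dbarConst t * starRingEnd ℂ (φ₁ v)) * f m = 0 := by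
  rw [mem_pluricanonicalSections_iff (fun _ _ _ => exists_eq_smul_of_isTypeZero)
    isCanonicalFrameOn_canonicalSection, isPseudoholomorphicInFrame_iff_of_dbarForm_eq_smul
      (fun m _ => canonicalSection_ne_zero m) fun m _ v => dbarForm_canonicalSection m v]
  simp only [mem_univ, true_implies, contMDiffOn_univ, forall_and]
  rfl

theorem mem_pluricanonicalSections_fibreJ_iff {σ : ∀ m : KT, TensorFibre (Fin 4 → ℝ) 2 k m} :
    σ ∈ pluricanonicalSections (fibreJ t) 2 k ↔
      ∃ a : ℂ, ∀ p, σ (proj p) = (a * Complex.exp ((2 * k * dbarConst t : ℝ) * p 0 * Complex.I)) •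
        formPow k (canonicalSection t) (proj p) := by
  rw [mem_pluricanonicalSections_fibreJ_iff_dbarFun]
  constructor
  · rintro ⟨f, hf, hσ, hdbar⟩
    have hbounded : Bornology.IsBounded (range (f ∘ proj)) :=
      (isCompact_range hf.continuous).isBounded.subset (range_comp_subset_range proj f)
    rw [dbarFun_add_eq_zero_iff (hf.mdifferentiable (by simp)), dbar_add_smul_eq_zero_iff
      ((hf.comp contMDiff_proj).contDiff.differentiable (by simp)) hbounded] at hdbar
    exact hdbar.imp fun a ha p => by rw [hσ, ← ha p, Function.comp_apply]
  · rintro ⟨a, ha⟩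
    set F : (Fin 4 → ℝ) → ℂ :=
      fun p => a * Complex.exp ((2 * k * dbarConst t : ℝ) * p 0 * Complex.I)
    have hlift : (fun m => F (lift m)) ∘ proj = F := funext fun p => by
      have h := ha (lift (proj p))
      rw [proj_lift, ha p] at h
      exact (smul_left_injective ℂ (formPow_ne_zero (canonicalSection_ne_zero _) k) h).symm
    have hF_smooth : ContDiff ℝ ∞ F := by
      have hcoord : ContDiff ℝ ∞ fun p : Fin 4 → ℝ => ((p 0 : ℝ) : ℂ) :=
        Complex.ofRealCLM.contDiff.comp (contDiff_apply ℝ ℝ (0 : Fin 4))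
      fun_prop
    have hsmooth : ContMDiff 𝓘(ℝ, Fin 4 → ℝ) 𝓘(ℝ, ℂ) ∞ fun m => F (lift m) := fun m =>
      contMDiffAt_of_comp_proj (by rw [hlift]; exact hF_smooth.contDiffAt)
    have hbounded : Bornology.IsBounded (range F) := by
      rw [← hlift]
      exact (isCompact_range hsmooth.continuous).isBounded.subset (range_comp_subset_range proj _)
    refine ⟨fun m => F (lift m), hsmooth, fun m => ?_, ?_⟩
    · conv_lhs => rw [← proj_lift m, ha, proj_lift]
    · rw [dbarFun_add_eq_zero_iff (hsmooth.mdifferentiable (by simp)), hlift,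
        dbar_add_smul_eq_zero_iff (hF_smooth.differentiable (by simp)) hbounded]
      exact ⟨a, fun _ => rfl⟩

end PluricanonicalSections

section Plurigenera

/-- The `k`-canonical sections over `t` are the multiples of `exp (2ikcx)`, which descends from `G`
to `M` exactly when `kc` is an integral multiple of `π`. -/
def IsResonant (t : ℂ) (k : ℕ) : Prop := ∃ n : ℤ, k * dbarConst t = n * Real.pi

variable {t : Δ} {k : ℕ}

theorem isResonant_of_mem_pluricanonicalSections {σ : ∀ m : KT, TensorFibre (Fin 4 → ℝ) 2 k m}
    (hσ : σ ∈ pluricanonicalSections (fibreJ t) 2 k) (hσ₀ : σ ≠ 0) : IsResonant t k := by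
  obtain ⟨a, ha⟩ := mem_pluricanonicalSections_fibreJ_iff.1 hσ
  have ha₀ : a ≠ 0 := by
    rintro rfl
    refine hσ₀ (funext (proj_surjective.forall.2 fun p => ?_))
    rw [ha, zero_mul]
    exact zero_smul ℂ (formPow k (canonicalSection t) (proj p))
  have hproj : proj ![1, 0, 0, 0] = proj 0 := by
    rw [proj_eq_iff_mem_range_intCast]
    exact ⟨⟨1, by simp⟩, ⟨0, by simp⟩, ⟨0, by simp⟩, ⟨0, by simp⟩⟩
  have hcoeff := ha ![1, 0, 0, 0]
  rw [hproj, ha 0] at hcoeff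
  have hexp := smul_left_injective ℂ (formPow_ne_zero (canonicalSection_ne_zero (proj 0)) k) hcoeff
  have hone : Complex.exp ((2 * k * dbarConst t : ℝ) * Complex.I) = 1 := by
    simpa [ha₀, eq_comm] using hexp
  obtain ⟨n, hn⟩ := Complex.exp_eq_one_iff.1 hone
  refine ⟨n, ?_⟩
  have hreal : 2 * k * dbarConst t = n * (2 * Real.pi) := by
    simpa using congrArg Complex.im hn
  linarith

theorem pluricanonicalSections_eq_bot (h : ¬ IsResonant t k) :
    pluricanonicalSections (fibreJ t) 2 k = ⊥ :=
  (Submodule.eq_bot_iff _).2 fun _ hσ =>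
    by_contra fun hσ₀ => h (isResonant_of_mem_pluricanonicalSections hσ hσ₀)

/-- The `k`-canonical section that spans all of them in the resonant case; without resonance it is
discontinuous, as it depends on the choice of `lift`. -/
noncomputable def expSection (t : Δ) (k : ℕ) (m : KT) : TensorFibre (Fin 4 → ℝ) 2 k m :=
  Complex.exp ((2 * k * dbarConst t : ℝ) * lift m 0 * Complex.I) • formPow k (canonicalSection t) m

theorem expSection_ne_zero : expSection t k ≠ 0 := fun h =>
  smul_ne_zero (Complex.exp_ne_zero _) (formPow_ne_zero (canonicalSection_ne_zero (proj 0)) k)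
    (congrFun h (proj 0))

theorem expSection_proj (h : IsResonant t k) (p : Fin 4 → ℝ) :
    expSection t k (proj p) = Complex.exp ((2 * k * dbarConst t : ℝ) * p 0 * Complex.I) •
      formPow k (canonicalSection t) (proj p) := by
  obtain ⟨n, hn⟩ := h
  obtain ⟨j, hj, -⟩ := exists_dproj_eq_shear_neg p
  have hx : p 0 = j 0 + lift (proj p) 0 := by
    conv_lhs => rw [hj]
    simp [coordMul]
  have hn_complex : (k * dbarConst t : ℂ) = n * Real.pi := by exact_mod_cast hn
  rw [expSection, Complex.exp_eq_exp_iff_exists_int.2 ⟨-(n * j 0), ?_⟩]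
  rw [hx]
  push_cast
  linear_combination (-2 * (j 0 : ℂ) * Complex.I) * hn_complex

theorem pluricanonicalSections_eq_span (h : IsResonant t k) :
    pluricanonicalSections (fibreJ t) 2 k = Submodule.span ℂ {expSection t k} := by
  ext σ
  rw [mem_pluricanonicalSections_fibreJ_iff, Submodule.mem_span_singleton]
  refine exists_congr fun a => ?_
  rw [funext_iff, proj_surjective.forall]
  refine forall_congr' fun p => ?_
  rw [mul_smul, ← expSection_proj h, eq_comm]
  rfl

theorem finite_pluricanonicalSections (t : Δ) (k : ℕ) :
    Module.Finite ℂ (pluricanonicalSections (fibreJ t) 2 k) := by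
  by_cases h : IsResonant t k
  · rw [pluricanonicalSections_eq_span h]
    infer_instance
  · rw [pluricanonicalSections_eq_bot h]
    infer_instance

theorem finrank_span_singleton_of_ne_zero {K V : Type*} [DivisionRing K] [AddCommMonoid V]
    [Module K V] {v : V} (hv : v ≠ 0) : Module.finrank K (Submodule.span K {v}) = 1 := by
  let _ : AddCommGroup V := Module.addCommMonoidToAddCommGroup K
  exact finrank_span_singleton hv

theorem fibrePlurigenus_of_isResonant (h : IsResonant t k) : fibrePlurigenus k t = 1 := by
  rw [fibrePlurigenus, plurigenus, pluricanonicalSections_eq_span h]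
  exact finrank_span_singleton_of_ne_zero expSection_ne_zero

theorem fibrePlurigenus_of_not_isResonant (h : ¬ IsResonant t k) : fibrePlurigenus k t = 0 := by
  rw [fibrePlurigenus, plurigenus, pluricanonicalSections_eq_bot h, finrank_bot]

theorem fibrePlurigenus_eq_indicator (k : ℕ) :
    fibrePlurigenus k = indicator {t : Δ | IsResonant t k} fun _ => 1 := by
  funext t
  by_cases h : t ∈ {t : Δ | IsResonant t k}
  · rw [fibrePlurigenus_of_isResonant h, indicator_of_mem h]
  · rw [fibrePlurigenus_of_not_isResonant h, indicator_of_notMem h]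

theorem isClosed_setOf_isResonant (k : ℕ) : IsClosed {t : Δ | IsResonant t k} := by
  have hcontinuous : Continuous fun t : Δ => k * dbarConst t / Real.pi := by
    unfold dbarConst
    have _ : Continuous fun t : Δ => (t : ℂ).re :=
      Complex.continuous_re.comp continuous_subtype_val
    fun_prop (disch := exact fun t => (mul_pos four_pos (Δ_re_add_pi_pos t)).ne')
  convert Real.isClosed_range_intCast.preimage hcontinuous using 1
  ext t
  simp only [mem_ofPred_eq, mem_preimage, mem_range, IsResonant, eq_div_iff Real.pi_ne_zero]
  exact exists_congr fun n => eq_comm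

theorem upperSemicontinuous_fibrePlurigenus (k : ℕ) : UpperSemicontinuous (fibrePlurigenus k) := by
  rw [fibrePlurigenus_eq_indicator]
  exact (isClosed_setOf_isResonant k).upperSemicontinuous_indicator zero_le_one

end Plurigenera

section RealParameters

variable {s : Ioo (-Real.pi) Real.pi}

theorem isResonant_realPoint_iff (s : Ioo (-Real.pi) Real.pi) (k : ℕ) :
    IsResonant (realPoint s) k ↔ ∃ n : ℤ, k * ((s : ℝ) + Real.pi) = 4 * n * Real.pi := by
  have hne : (s : ℝ) + Real.pi ≠ 0 := by linarith [s.2.1]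
  have hconst : dbarConst (realPoint s) = ((s : ℝ) + Real.pi) / 4 := by
    rw [dbarConst, norm_add_pi_sq]
    simp [realPoint]
    field_simp
  refine exists_congr fun n => ?_
  rw [hconst]
  constructor <;> intro h <;> linarith

theorem mem_piRat_of_isResonant {k : ℕ} (hk : 1 ≤ k) (h : IsResonant (realPoint s) k) :
    (s : ℝ) ∈ piRat := by
  obtain ⟨n, hn⟩ := (isResonant_realPoint_iff s k).1 h
  have hk₀ : (k : ℝ) ≠ 0 := by positivity
  refine ⟨4 * n / k - 1, ?_⟩
  push_cast
  field_simp
  linarith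

theorem isResonant_of_eq_pi_mul {q : ℚ} (hq : (s : ℝ) = Real.pi * q) (j : ℕ) :
    IsResonant (realPoint s) (4 * q.den * j) := by
  rw [isResonant_realPoint_iff]
  refine ⟨j * (q.num + q.den), ?_⟩
  have hnum : (q.den : ℝ) * q = q.num := by exact_mod_cast Rat.den_mul_eq_num q
  rw [hq]
  push_cast
  linear_combination (4 * (j : ℝ) * Real.pi) * hnum

theorem fibreKod_of_notMem_piRat (hs : (s : ℝ) ∉ piRat) : fibreKod (realPoint s) = ⊥ :=
  kodairaDim_eq_bot fun _ hm =>
    fibrePlurigenus_of_not_isResonant fun h => hs (mem_piRat_of_isResonant hm h)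

theorem fibreKod_of_mem_piRat (hs : (s : ℝ) ∈ piRat) : fibreKod (realPoint s) = 0 := by
  obtain ⟨q, hq⟩ := hs
  refine kodairaDim_eq_zero (fun k => ?_) (Filter.frequently_atTop.2 fun j =>
    ⟨4 * q.den * j, by nlinarith [q.den_pos],
      fibrePlurigenus_of_isResonant (isResonant_of_eq_pi_mul hq j)⟩)
  by_cases h : IsResonant (realPoint s) k
  · exact (fibrePlurigenus_of_isResonant h).le
  · exact (fibrePlurigenus_of_not_isResonant h).trans_le zero_le_one

theorem piRat_eq_range : piRat = range fun q : ℚ => Real.pi * (q : ℝ) :=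
  ext fun _ => exists_congr fun _ => eq_comm

theorem dense_piRat : Dense piRat := by
  rw [piRat_eq_range]
  exact (mul_left_surjective₀ Real.pi_ne_zero).denseRange.comp Rat.denseRange_cast (by fun_prop)

theorem dense_compl_piRat : Dense piRatᶜ := by
  rw [piRat_eq_range]
  exact (countable_range _).dense_compl ℝ

theorem frequently_mem_of_dense {X : Type*} [TopologicalSpace X] {D U : Set X} (hD : Dense D)
    (hU : IsOpen U) (x : U) : ∃ᶠ y : U in 𝓝 x, (y : X) ∈ D :=
  mem_closure_iff_frequently.1 (hD.preimage hU.isOpenMap_subtype_val x)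

theorem not_upperSemicontinuousAt (hs : (s : ℝ) ∉ piRat) :
    ¬ UpperSemicontinuousAt (fun r => fibreKod (realPoint r)) s := by
  intro h
  have hlt := h 0 (by simp [fibreKod_of_notMem_piRat hs])
  obtain ⟨r, hr, hrlt⟩ :=
    ((frequently_mem_of_dense dense_piRat isOpen_Ioo s).and_eventually hlt).exists
  exact hrlt.ne (fibreKod_of_mem_piRat hr)

theorem not_lowerSemicontinuousAt (hs : (s : ℝ) ∈ piRat) :
    ¬ LowerSemicontinuousAt (fun r => fibreKod (realPoint r)) s := by
  intro h
  have hlt := h ⊥ (by simp [fibreKod_of_mem_piRat hs])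
  obtain ⟨r, hr, hrlt⟩ :=
    ((frequently_mem_of_dense dense_compl_piRat isOpen_Ioo s).and_eventually hlt).exists
  exact hrlt.ne' (fibreKod_of_notMem_piRat hr)

theorem continuous_realPoint : Continuous realPoint :=
  Continuous.subtype_mk (Complex.continuous_ofReal.comp continuous_subtype_val) _

theorem not_upperSemicontinuous_fibreKod : ¬ UpperSemicontinuous fibreKod := by
  intro h
  obtain ⟨s, hs, hs_mem⟩ := dense_compl_piRat.exists_mem_open isOpen_Ioo
    (nonempty_Ioo.2 (neg_lt_self Real.pi_pos))
  exact not_upperSemicontinuousAt (s := ⟨s, hs_mem⟩) hs (h.comp continuous_realPoint _)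

theorem not_lowerSemicontinuous_fibreKod : ¬ LowerSemicontinuous fibreKod := by
  intro h
  obtain ⟨s, hs, hs_mem⟩ := dense_piRat.exists_mem_open isOpen_Ioo
    (nonempty_Ioo.2 (neg_lt_self Real.pi_pos))
  exact not_lowerSemicontinuousAt (s := ⟨s, hs_mem⟩) hs (h.comp continuous_realPoint _)

end RealParameters

end KodairaThurston

theorem mainTheorem1 :
    -- `M` is compact and Hausdorff, and the fields `e₁, …, e₄` descend to `M`
    (CompactSpace KodairaThurston.KT ∧ T2Space KodairaThurston.KT ∧
      ContMDiff 𝓘(ℝ, Fin 4 → ℝ) 𝓘(ℝ, Fin 4 → ℝ) ∞ KodairaThurston.proj ∧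
      ∀ (p : Fin 4 → ℝ) (i : Fin 4),
        mfderiv 𝓘(ℝ, Fin 4 → ℝ) 𝓘(ℝ, Fin 4 → ℝ) KodairaThurston.proj p
          (KodairaThurston.field i p) = KodairaThurston.frame i (KodairaThurston.proj p)) ∧
    -- `J` is an almost complex structure on `M × Δ` and the projection is pseudoholomorphic
    AlmostComplex.IsAlmostComplexStructure (𝓘(ℝ, Fin 4 → ℝ).prod 𝓘(ℝ, ℂ))
      KodairaThurston.totalJ ∧
    AlmostComplex.IsPseudoholomorphic (𝓘(ℝ, Fin 4 → ℝ).prod 𝓘(ℝ, ℂ)) 𝓘(ℝ, ℂ)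
      KodairaThurston.totalJ KodairaThurston.stdJ
      (Prod.snd : KodairaThurston.KT × KodairaThurston.Δ → KodairaThurston.Δ) ∧
    -- every fibre `M_t` is an almost complex submanifold, by means of `J_t`
    (∀ t : KodairaThurston.Δ,
      AlmostComplex.IsAlmostComplexStructure 𝓘(ℝ, Fin 4 → ℝ) (KodairaThurston.fibreJ t) ∧
      AlmostComplex.IsPseudoholomorphic 𝓘(ℝ, Fin 4 → ℝ) (𝓘(ℝ, Fin 4 → ℝ).prod 𝓘(ℝ, ℂ))
        (KodairaThurston.fibreJ t) KodairaThurston.totalJ (KodairaThurston.fibreIncl t)) ∧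
    -- the Kodaira dimension of the fibres over real `t`
    (∀ s : Ioo (-Real.pi) Real.pi,
      ((s : ℝ) ∉ KodairaThurston.piRat →
        KodairaThurston.fibreKod (KodairaThurston.realPoint s) = ⊥) ∧
      ((s : ℝ) ∈ KodairaThurston.piRat →
        KodairaThurston.fibreKod (KodairaThurston.realPoint s) = 0)) ∧
    -- each plurigenus is (finite and) upper semicontinuous on `Δ`
    (∀ m : ℕ, 1 ≤ m →
      (∀ t : KodairaThurston.Δ, Module.Finite ℂ
        (AlmostComplex.pluricanonicalSections (KodairaThurston.fibreJ t) 2 m)) ∧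
      UpperSemicontinuous (KodairaThurston.fibrePlurigenus m)) ∧
    -- the Kodaira dimension is not semicontinuous
    (¬ UpperSemicontinuous KodairaThurston.fibreKod ∧
      ¬ LowerSemicontinuous KodairaThurston.fibreKod) ∧
    (∀ s : Ioo (-Real.pi) Real.pi,
      ((s : ℝ) ∉ KodairaThurston.piRat → ¬ UpperSemicontinuousAt
        (fun r => KodairaThurston.fibreKod (KodairaThurston.realPoint r)) s) ∧
      ((s : ℝ) ∈ KodairaThurston.piRat → ¬ LowerSemicontinuousAt
        (fun r => KodairaThurston.fibreKod (KodairaThurston.realPoint r)) s)) := by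
  open KodairaThurston in
  refine ⟨⟨inferInstance, inferInstance, contMDiff_proj, mfderiv_proj_field⟩,
    isAlmostComplexStructure_totalJ, isPseudoholomorphic_snd,
    fun t => ⟨isAlmostComplexStructure_fibreJ t, isPseudoholomorphic_fibreIncl t⟩,
    fun s => ⟨fibreKod_of_notMem_piRat, fibreKod_of_mem_piRat⟩,
    fun k _ => ⟨fun t => finite_pluricanonicalSections t k, upperSemicontinuous_fibrePlurigenus k⟩,
    ⟨not_upperSemicontinuous_fibreKod, not_lowerSemicontinuous_fibreKod⟩,
    fun s => ⟨not_upperSemicontinuousAt, not_lowerSemicontinuousAt⟩⟩
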